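/- Let $m,K\ge 0$ be integers, $M=\mathbb R^m$ with the Euclidean norm, and consider Gaussian mixtures $p_0=\sum_{k=1}^K\pi_k\,\mathcal N(\mu_k,\Sigma_k)$ on $M$ with $\pi_k\ge 0$, $\sum_k\pi_k=1$, $\mu_k\in M$, $\Sigma_k$ positive definite. Write $d_k(x)^2=(x-\mu_k)^\top\Sigma_k^{-1}(x-\mu_k)$, let $\le$ between symmetric matrices be the Loewner order, and let $d_{LP}$ be the Lévy–Prokhorov distance of measures, which metrizes weak convergence of probability measures. *The maps.* The ordinary DAE trained for $p_0$ is $\Phi_t=\mathrm{Id}+t\,\nabla\log[W_{t/2}*p_0]$, where $W_t(z)=(4\pi t)^{-m/2}e^{-|z|^2/4t}$ (so $\Phi_0=\mathrm{Id}$). A continuous DAE trained for $p_0$ on $[0,T)$ is a family of measurable maps $\varphi_t:M\to M$ with $\varphi_0=\mathrm{Id}$ such that $p_t:=\varphi_{t\sharp}p_0$ has a positive differentiable density (also written $p_t$) whose score $\nabla\log p_t(x)$ is continuous in $(t,x)\in[0,T)\times M$, and $\partial_t\varphi_t(x)=\nabla\log p_t(\varphi_t(x))$ for all $x\in M$, $t\in[0,T)$.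 Their affine models at the $k$-th cluster are $$\Phi_{kt}(x)=(I+t\Sigma_k^{-1})^{-1}(x-\mu_k)+\mu_k,\qquad \varphi_{kt}(x)=\sqrt{I-2t\Sigma_k^{-1}}\,(x-\mu_k)+\mu_k .$$ *Well-separation.* Given positive definite matrices $S_1,\dots,S_K$, put $\gamma_k(x)=\pi_k\mathcal N(x;\mu_k,S_k)/\sum_j\pi_j\mathcal N(x;\mu_j,S_j)$. The mixture is $\varepsilon$-well-separated for $(S_k)$ with clusters $\Omega_1,\dots,\Omega_K\subseteq M$ if for every $k$ the set $\Omega_k$ is a neighborhood of $\mu_k$, $\mathcal N(\Omega_k;\mu_k,\Sigma_k)\ge 1-\varepsilon$, and $\gamma_k\ge 1-\varepsilon$ on $\Omega_k$. Then the following hold. 1. (Continuous DAE, exact pushforward.) If $\varphi$ is a continuous DAE trained for $p_0$ on $[0,T)$, then for every $t\in[0,T)$ such that all the $\Sigma_k-2tI$ are positive definite, $$\varphi_{t\sharp}p_0=\sum_{k=1}^K\pi_k\,\mathcal N(\mu_k,\Sigma_k-2tI).$$ 2. (Ordinary DAE, approximate pushforward.) For all $R,w,r,\delta>0$ there is $\varepsilon>0$,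 depending only on $m,K,R,w,r,\delta$, such that for every mixture with $\Sigma_k\le R\,I$ for all $k$ and every $t\in[0,R]$: if the mixture is $\varepsilon$-well-separated for $(\Sigma_k+tI)_k$ with clusters $\Omega_k$, then $$d_{LP}\Big(\Phi_{t\sharp}p_0,\ \sum_{k=1}^K\pi_k\,\mathcal N\big(\mu_k,\Sigma_k(I+t\Sigma_k^{-1})^{-2}\big)\Big)\le\delta,$$ and for every $k$ with $\pi_k\ge w$ and every $x\in\Omega_k$ with $d_k(x)\le r$, $|\Phi_t(x)-\Phi_{kt}(x)|\le\delta$. 3. (Continuous DAE on the clusters.) For all $\kappa,R,w,r,\delta>0$ there is $\varepsilon>0$, depending only on $m,K,\kappa,R,w,r,\delta$, such that for every mixture with $\Sigma_k\le R\,I$ for all $k$, every continuous DAE $\varphi$ trained for it on $[0,T)$ and every $t\in[0,T)$ with $\Sigma_k-2tI\ge\kappa I$ for all $k$: if there are sets $\Omega_1,\dots,\Omega_K$ such that for every $s\in[0,t]$ the mixture is $\varepsilon$-well-separated for $(\Sigma_k-2sI)_k$ with the clusters $\Omega_k$, then for every $k$ with $\pi_k\ge w$ and every $x$ with $d_k(x)\le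 r$, $|\varphi_t(x)-\varphi_{kt}(x)|\le\delta$. 4. (Contractions toward the centers.) For every mixture, every $k$ and every $t>0$, $\Phi_{kt}(\mu_k)=\mu_k$ and $\Phi_{kt}$ is Lipschitz with a constant less than $1$; if $\Sigma_k-2tI$ is positive definite, then also $\varphi_{kt}(\mu_k)=\mu_k$ and $\varphi_{kt}$ is Lipschitz with a constant less than $1$. -/

import Mathlib

open MeasureTheory ProbabilityTheory Set Topology
open scoped Matrix MatrixOrder NNReal ENNReal

noncomputable section

/-- The ground space `ℝᵐ` with its Euclidean norm. -/
abbrev Ground (m : ℕ) : Type := EuclideanSpace ℝ (Fin m)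

/-- The linear map `v ↦ A v` of the Euclidean space. -/
def matAct {m : ℕ} (A : Matrix (Fin m) (Fin m) ℝ) (v : Ground m) : Ground m :=
  WithLp.toLp 2 (A *ᵥ v.ofLp)

/-- The squared Mahalanobis distance `(x - μ)ᵀ S⁻¹ (x - μ)`. -/
def mahalanobisSq {m : ℕ} (μ : Ground m) (S : Matrix (Fin m) (Fin m) ℝ) (x : Ground m) : ℝ :=
  (x - μ).ofLp ⬝ᵥ (S⁻¹ *ᵥ (x - μ).ofLp)

/-- The value `N(x; μ, S)` at `x` of the Gaussian density (for positive definite `S`). -/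
def gaussianDensity {m : ℕ} (μ : Ground m) (S : Matrix (Fin m) (Fin m) ℝ) (x : Ground m) : ℝ :=
  (Real.sqrt ((2 * Real.pi) ^ m * S.det))⁻¹ * Real.exp (-(1 / 2) * mahalanobisSq μ S x)

/-- The heat kernel `W_t(z) = (4 π t)^{-m/2} exp (-|z|² / (4 t))`, for `t > 0`. -/
def heatKernel {m : ℕ} (t : ℝ) (z : Ground m) : ℝ :=
  (4 * Real.pi * t) ^ (-(m : ℝ) / 2) * Real.exp (-‖z‖ ^ 2 / (4 * t))

/-- The function `W_t * p`, for a measure `p`. -/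
def heatConv {m : ℕ} (t : ℝ) (p : Measure (Ground m)) (x : Ground m) : ℝ :=
  ∫ y, heatKernel t (x - y) ∂p

/-- The score `∇ log ρ`. -/
def score {m : ℕ} (ρ : Ground m → ℝ) (x : Ground m) : Ground m :=
  gradient (fun y => Real.log (ρ y)) x

/-- The (ordinary) denoising autoencoder `Φ_t = Id + t ∇ log (W_{t/2} * p₀)` trained for `p₀`. -/
def dae {m : ℕ} (p₀ : Measure (Ground m)) (t : ℝ) (x : Ground m) : Ground m :=
  x + t • score (heatConv (t / 2) p₀) x

/-- `φ` is a continuous denoising autoencoder trained for `p₀` on the time interval `[0, T)`: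
`φ_0 = Id`, the pushforward `p_t = φ_t♯ p₀` has a positive differentiable density `ρ_t` with a
score `∇ log ρ_t(x)` that is continuous in `(t, x)`, and every orbit `t ↦ φ_t(x)` solves
`dx/dt = ∇ log p_t (x)` on `[0, T)` (with the one-sided derivative at `t = 0`). -/
def IsContinuousDAE {m : ℕ} (p₀ : Measure (Ground m)) (T : ℝ) (φ : ℝ → Ground m → Ground m) :
    Prop :=
  (∀ x, φ 0 x = x) ∧
  (∀ t ∈ Ico 0 T, Measurable (φ t)) ∧
  ∃ ρ : ℝ → Ground m → ℝ,
    (∀ t ∈ Ico 0 T, (∀ x, 0 < ρ t x) ∧ Differentiable ℝ (ρ t) ∧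
      p₀.map (φ t) = volume.withDensity (fun x => ENNReal.ofReal (ρ t x))) ∧
    ContinuousOn (fun z : ℝ × Ground m => score (ρ z.1) z.2) (Ico 0 T ×ˢ univ) ∧
    ∀ x, ∀ t ∈ Ico 0 T, HasDerivWithinAt (fun s => φ s x) (score (ρ t) (φ t x)) (Ico 0 T) t

/-- The measure `∑ₖ πₖ N(μₖ, Sₖ)`. -/
def gaussianSum {m K : ℕ} (π : Fin K → ℝ) (μ : Fin K → Ground m)
    (S : Fin K → Matrix (Fin m) (Fin m) ℝ) : Measure (Ground m) :=
  ∑ k, ENNReal.ofReal (π k) • multivariateGaussian (μ k) (S k)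

/-- The parameters of a mixture of `K` nondegenerate Gaussians on `ℝᵐ`. -/
structure GaussianMixture (m K : ℕ) where
  /-- the mixing weights -/
  weight : Fin K → ℝ
  /-- the cluster centers -/
  mean : Fin K → Ground m
  /-- the covariance matrices -/
  cov : Fin K → Matrix (Fin m) (Fin m) ℝ
  weight_nonneg : ∀ k, 0 ≤ weight k
  weight_sum : ∑ k, weight k = 1
  cov_posDef : ∀ k, (cov k).PosDef

namespace GaussianMixture

variable {m K : ℕ}

/-- The distribution `p₀ = ∑ₖ πₖ N(μₖ, Σₖ)`. -/
def law (G : GaussianMixture m K) : Measure (Ground m) :=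
  gaussianSum G.weight G.mean G.cov

/-- `Σₖ - 2 t I`, the covariances for the continuous DAE. -/
def contCov (G : GaussianMixture m K) (t : ℝ) (k : Fin K) : Matrix (Fin m) (Fin m) ℝ :=
  G.cov k - (2 * t) • (1 : Matrix (Fin m) (Fin m) ℝ)

/-- `Σₖ + t I`, the covariances in the responsibilities of the ordinary DAE. -/
def noisyCov (G : GaussianMixture m K) (t : ℝ) (k : Fin K) : Matrix (Fin m) (Fin m) ℝ :=
  G.cov k + t • (1 : Matrix (Fin m) (Fin m) ℝ)

/-- The responsibility `πₖ N(x; μₖ, Sₖ) / ∑ⱼ πⱼ N(x; μⱼ, Sⱼ)`. -/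
def resp (G : GaussianMixture m K) (S : Fin K → Matrix (Fin m) (Fin m) ℝ) (k : Fin K)
    (x : Ground m) : ℝ :=
  G.weight k * gaussianDensity (G.mean k) (S k) x /
    ∑ j, G.weight j * gaussianDensity (G.mean j) (S j) x

/-- Well-separation up to the tolerance `ε` through the clusters `Ωₖ`: each `Ωₖ` is a neighborhood
of `μₖ`, it carries `N(μₖ, Σₖ)` up to mass `ε`, and on it the `k`-th responsibility is `1` up to
`ε` (so that there all the others are `0` up to `ε`, as the responsibilities sum to `1`). -/
def WellSeparated (G : GaussianMixture m K) (S : Fin K → Matrix (Fin m) (Fin m) ℝ)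
    (Ω : Fin K → Set (Ground m)) (ε : ℝ) : Prop :=
  ∀ k, Ω k ∈ 𝓝 (G.mean k) ∧
    ENNReal.ofReal (1 - ε) ≤ multivariateGaussian (G.mean k) (G.cov k) (Ω k) ∧
    ∀ x ∈ Ω k, 1 - ε ≤ G.resp S k x

/-- The affine map `x ↦ √(I - 2 t Σₖ⁻¹) (x - μₖ) + μₖ`. -/
def contAffine (G : GaussianMixture m K) (t : ℝ) (k : Fin K) (x : Ground m) : Ground m :=
  matAct (CFC.sqrt (1 - (2 * t) • (G.cov k)⁻¹)) (x - G.mean k) + G.mean k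

/-- The affine map `x ↦ (I + t Σₖ⁻¹)⁻¹ (x - μₖ) + μₖ`. -/
def daeAffine (G : GaussianMixture m K) (t : ℝ) (k : Fin K) (x : Ground m) : Ground m :=
  matAct (1 + t • (G.cov k)⁻¹)⁻¹ (x - G.mean k) + G.mean k

/-- `Σₖ (I + t Σₖ⁻¹)⁻²`, the covariances for the ordinary DAE. -/
def daeCov (G : GaussianMixture m K) (t : ℝ) (k : Fin K) : Matrix (Fin m) (Fin m) ℝ :=
  G.cov k * ((1 + t • (G.cov k)⁻¹)⁻¹) ^ 2

end GaussianMixture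

end

/-!
The score of a Gaussian mixture with covariances `Sₖ` is the average of the component scores
`-Sₖ⁻¹ (x - μₖ)`, weighted by the responsibilities `γₖ`.

For the continuous DAE, the continuity equation with velocity `∇ log p_t` is the backward heat
equation `∂ₜ p_t = -Δ p_t`. Tested against plane waves, cut off smoothly, it says that
`exp (-t |ξ|²) p̂_t(ξ)` does not depend on `t`, which identifies `p_t` as the mixture with
covariances `Σₖ - 2tI`. The orbits of the DAE therefore solve an explicit differential equation.

Where `γₖ ≥ 1 - ε`, the terms `γⱼ |Sⱼ⁻¹ (x - μⱼ)|` with `j ≠ k` are small even if `μⱼ` is far away: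
a power of the small `γⱼ` is kept, and the rest is bounded by its Gaussian tail, which beats the
linear growth. So on the clusters each DAE moves almost as if the `k`-th component were alone. For
the ordinary DAE this is the estimate to prove; as the clusters carry almost all the mass, coupling
the image of each component with its affine image bounds the Lévy–Prokhorov distance. For the
continuous DAE, an orbit might leave its cluster, but separation at the center `μₖ` propagates to
balls around it by comparing Gaussian densities, and the Grönwall inequality in a tube around
the affine flow, which solves the equation of a single Gaussian, finishes the proof.
-/

/-! ### Quadratic forms and the Loewner order -/

section LinearAlgebra

variable {m : ℕ} {A B S S' : Matrix (Fin m) (Fin m) ℝ}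

theorem matAct_eq_toEuclideanCLM (A : Matrix (Fin m) (Fin m) ℝ) (v : Ground m) :
    matAct A v = Matrix.toEuclideanCLM (𝕜 := ℝ) A v := rfl

theorem matAct_add (A : Matrix (Fin m) (Fin m) ℝ) (v w : Ground m) :
    matAct A (v + w) = matAct A v + matAct A w := by
  simp only [matAct_eq_toEuclideanCLM, map_add]

theorem matAct_sub (A : Matrix (Fin m) (Fin m) ℝ) (v w : Ground m) :
    matAct A (v - w) = matAct A v - matAct A w := by
  simp only [matAct_eq_toEuclideanCLM, map_sub]

theorem matAct_smul (A : Matrix (Fin m) (Fin m) ℝ) (c : ℝ) (v : Ground m) :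
    matAct A (c • v) = c • matAct A v := by
  simp only [matAct_eq_toEuclideanCLM, map_smul]

@[simp] theorem matAct_zero (A : Matrix (Fin m) (Fin m) ℝ) : matAct A (0 : Ground m) = 0 := by
  simp only [matAct_eq_toEuclideanCLM, map_zero]

theorem add_matAct (A B : Matrix (Fin m) (Fin m) ℝ) (v : Ground m) :
    matAct (A + B) v = matAct A v + matAct B v := by
  simp [matAct_eq_toEuclideanCLM]

theorem sub_matAct (A B : Matrix (Fin m) (Fin m) ℝ) (v : Ground m) :
    matAct (A - B) v = matAct A v - matAct B v := by
  simp [matAct_eq_toEuclideanCLM]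

theorem smul_matAct (c : ℝ) (A : Matrix (Fin m) (Fin m) ℝ) (v : Ground m) :
    matAct (c • A) v = c • matAct A v := by
  simp [matAct_eq_toEuclideanCLM]

@[simp] theorem one_matAct (v : Ground m) : matAct 1 v = v := by
  simp [matAct_eq_toEuclideanCLM]

theorem mul_matAct (A B : Matrix (Fin m) (Fin m) ℝ) (v : Ground m) :
    matAct (A * B) v = matAct A (matAct B v) := by
  simp [matAct_eq_toEuclideanCLM]

@[fun_prop] theorem continuous_matAct (A : Matrix (Fin m) (Fin m) ℝ) :
    Continuous (fun v : Ground m => matAct A v) := by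
  simp only [matAct_eq_toEuclideanCLM]; fun_prop

@[fun_prop] theorem measurable_matAct (A : Matrix (Fin m) (Fin m) ℝ) :
    Measurable (fun v : Ground m => matAct A v) := (continuous_matAct A).measurable

theorem matAct_inv_matAct (hA : IsUnit A) (x : Ground m) : matAct A⁻¹ (matAct A x) = x := by
  rw [← mul_matAct, Matrix.nonsing_inv_mul _ ((Matrix.isUnit_iff_isUnit_det A).1 hA), one_matAct]

theorem matAct_matAct_inv (hA : IsUnit A) (x : Ground m) : matAct A (matAct A⁻¹ x) = x := by
  rw [← mul_matAct, Matrix.mul_nonsing_inv _ ((Matrix.isUnit_iff_isUnit_det A).1 hA), one_matAct]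

theorem inner_matAct (A : Matrix (Fin m) (Fin m) ℝ) (x y : Ground m) :
    inner ℝ x (matAct A y) = x.ofLp ⬝ᵥ A *ᵥ y.ofLp :=
  Matrix.inner_toEuclideanCLM A x y

theorem inner_matAct_left (A : Matrix (Fin m) (Fin m) ℝ) (x y : Ground m) :
    inner ℝ (matAct A x) y = inner ℝ x (matAct Aᵀ y) := by
  rw [real_inner_comm, inner_matAct, inner_matAct, Matrix.dotProduct_mulVec,
    ← Matrix.mulVec_transpose, dotProduct_comm]

theorem inner_matAct_left_of_isHermitian (hA : A.IsHermitian) (x y : Ground m) :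
    inner ℝ (matAct A x) y = inner ℝ x (matAct A y) := by
  rw [inner_matAct_left, ← Matrix.conjTranspose_eq_transpose_of_trivial, hA]

theorem inner_matAct_self_nonneg (hA : A.PosSemidef) (x : Ground m) :
    0 ≤ inner ℝ x (matAct A x) := by
  rw [inner_matAct]; simpa using hA.dotProduct_mulVec_nonneg x.ofLp

theorem inner_matAct_self_mono (h : A ≤ B) (x : Ground m) :
    inner ℝ x (matAct A x) ≤ inner ℝ x (matAct B x) := by
  have := inner_matAct_self_nonneg (Matrix.le_iff.1 h) x
  rwa [sub_matAct, inner_sub_right, sub_nonneg] at this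

theorem inner_smul_one_matAct_self (c : ℝ) (x : Ground m) :
    inner ℝ x (matAct (c • 1) x) = c * ‖x‖ ^ 2 := by
  rw [smul_matAct, one_matAct, inner_smul_right, real_inner_self_eq_norm_sq]

theorem inner_matAct_self_le {R : ℝ} (hR : A ≤ R • 1) (x : Ground m) :
    inner ℝ x (matAct A x) ≤ R * ‖x‖ ^ 2 :=
  inner_smul_one_matAct_self R x ▸ inner_matAct_self_mono hR x

theorem le_inner_matAct_self {κ : ℝ} (hκ : κ • 1 ≤ A) (x : Ground m) :
    κ * ‖x‖ ^ 2 ≤ inner ℝ x (matAct A x) :=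
  inner_smul_one_matAct_self κ x ▸ inner_matAct_self_mono hκ x

theorem posSemidef_sqrt (A : Matrix (Fin m) (Fin m) ℝ) : (CFC.sqrt A).PosSemidef :=
  Matrix.nonneg_iff_posSemidef.1 (CFC.sqrt_nonneg A)

theorem norm_sq_matAct_sqrt (hA : A.PosSemidef) (x : Ground m) :
    ‖matAct (CFC.sqrt A) x‖ ^ 2 = inner ℝ x (matAct A x) := by
  rw [← real_inner_self_eq_norm_sq, inner_matAct_left_of_isHermitian (posSemidef_sqrt A).1,
    ← mul_matAct, CFC.sqrt_mul_sqrt_self A hA.nonneg]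

theorem norm_sq_matAct_le {R : ℝ} (hA : A.PosSemidef) (hR : A ≤ R • 1) (x : Ground m) :
    ‖matAct A x‖ ^ 2 ≤ R * inner ℝ x (matAct A x) := by
  have hsqrt : matAct A x = matAct (CFC.sqrt A) (matAct (CFC.sqrt A) x) := by
    rw [← mul_matAct, CFC.sqrt_mul_sqrt_self A hA.nonneg]
  calc ‖matAct A x‖ ^ 2 = inner ℝ (matAct (CFC.sqrt A) x) (matAct A (matAct (CFC.sqrt A) x)) := by
        rw [hsqrt, norm_sq_matAct_sqrt hA]
    _ ≤ R * ‖matAct (CFC.sqrt A) x‖ ^ 2 := inner_matAct_self_le hR _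
    _ = R * inner ℝ x (matAct A x) := by rw [norm_sq_matAct_sqrt hA]

theorem posDef_sqrt (hS : S.PosDef) : (CFC.sqrt S).PosDef :=
  Matrix.isStrictlyPositive_iff_posDef.1 hS.isStrictlyPositive.sqrt

theorem exists_pos_smul_one_le (hS : S.PosDef) : ∃ c : ℝ, 0 < c ∧ c • 1 ≤ S := by
  cases subsingleton_or_nontrivial (Matrix (Fin m) (Fin m) ℝ)
  · exact ⟨1, one_pos, (Subsingleton.elim _ _).le⟩
  · obtain ⟨c, hc, hcS⟩ := (CFC.exists_pos_algebraMap_le_iff hS.1).2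
      fun _ => hS.isStrictlyPositive.spectrum_pos
    exact ⟨c, hc, by rwa [← Algebra.algebraMap_eq_smul_one]⟩

theorem posSemidef_smul_one {c : ℝ} (hc : 0 ≤ c) :
    (c • (1 : Matrix (Fin m) (Fin m) ℝ)).PosSemidef := Matrix.PosSemidef.one.smul hc

theorem posDef_add_smul_one (hS : S.PosDef) {t : ℝ} (ht : 0 ≤ t) : (S + t • 1).PosDef :=
  hS.add_posSemidef (posSemidef_smul_one ht)

theorem posDef_of_smul_one_le {κ : ℝ} (hκ : 0 < κ) (h : κ • 1 ≤ S) : S.PosDef := by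
  simpa using (Matrix.PosDef.one.smul hκ).add_posSemidef (Matrix.le_iff.1 h)

theorem posDef_one_add_smul_inv (hS : S.PosDef) {t : ℝ} (ht : 0 ≤ t) : (1 + t • S⁻¹).PosDef :=
  Matrix.PosDef.one.add_posSemidef (hS.inv.posSemidef.smul ht)

theorem eigenvalues_eq_inner (hS : S.IsHermitian) (i : Fin m) :
    hS.eigenvalues i = inner ℝ (hS.eigenvectorBasis i) (matAct S (hS.eigenvectorBasis i)) := by
  rw [hS.eigenvalues_eq, inner_matAct]; simp

theorem eigenvalues_le {R : ℝ} (hS : S.IsHermitian) (hR : S ≤ R • 1) (i : Fin m) :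
    hS.eigenvalues i ≤ R := by
  simpa [eigenvalues_eq_inner hS, hS.eigenvectorBasis.norm_eq_one]
    using inner_matAct_self_le hR (hS.eigenvectorBasis i)

theorem le_eigenvalues {κ : ℝ} (hS : S.IsHermitian) (hκ : κ • 1 ≤ S) (i : Fin m) :
    κ ≤ hS.eigenvalues i := by
  simpa [eigenvalues_eq_inner hS, hS.eigenvectorBasis.norm_eq_one]
    using le_inner_matAct_self hκ (hS.eigenvectorBasis i)

theorem det_le_pow {R : ℝ} (hS : S.PosSemidef) (hR : S ≤ R • 1) : S.det ≤ R ^ m := by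
  rw [hS.1.det_eq_prod_eigenvalues]
  simpa using Finset.prod_le_prod (s := Finset.univ) (fun i _ => hS.eigenvalues_nonneg i)
    fun i _ => eigenvalues_le hS.1 hR i

theorem pow_le_det {κ : ℝ} (h0 : 0 ≤ κ) (hS : S.IsHermitian) (hκ : κ • 1 ≤ S) :
    κ ^ m ≤ S.det := by
  rw [hS.det_eq_prod_eigenvalues]
  simpa using Finset.prod_le_prod (s := Finset.univ) (fun _ _ => h0)
    fun i _ => le_eigenvalues hS hκ i

theorem mahalanobisSq_eq_inner (μ : Ground m) (S : Matrix (Fin m) (Fin m) ℝ) (x : Ground m) :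
    mahalanobisSq μ S x = inner ℝ (x - μ) (matAct S⁻¹ (x - μ)) := by
  rw [inner_matAct]; rfl

@[fun_prop] theorem continuous_mahalanobisSq (μ : Ground m) (S : Matrix (Fin m) (Fin m) ℝ) :
    Continuous (mahalanobisSq μ S) := by
  simp only [funext (mahalanobisSq_eq_inner μ S)]; fun_prop

theorem mahalanobisSq_nonneg (hS : S.PosDef) (μ x : Ground m) : 0 ≤ mahalanobisSq μ S x := by
  rw [mahalanobisSq_eq_inner]; exact inner_matAct_self_nonneg hS.inv.posSemidef _

theorem mahalanobisSq_add_matAct_sqrt (hS : S.PosDef) (μ z : Ground m) :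
    mahalanobisSq μ S (μ + matAct (CFC.sqrt S) z) = ‖z‖ ^ 2 := by
  have hsqrt := posDef_sqrt hS
  have hinv : S⁻¹ = (CFC.sqrt S)⁻¹ * (CFC.sqrt S)⁻¹ := by
    rw [← Matrix.mul_inv_rev, CFC.sqrt_mul_sqrt_self S hS.posSemidef.nonneg]
  rw [mahalanobisSq_eq_inner, add_sub_cancel_left, hinv, mul_matAct,
    matAct_inv_matAct hsqrt.isUnit, inner_matAct_left_of_isHermitian hsqrt.1,
    matAct_matAct_inv hsqrt.isUnit, real_inner_self_eq_norm_sq]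

theorem norm_sq_sub_le_mul_mahalanobisSq {R : ℝ} (hS : S.PosDef) (hR : S ≤ R • 1)
    (μ x : Ground m) : ‖x - μ‖ ^ 2 ≤ R * mahalanobisSq μ S x := by
  have h := norm_sq_matAct_le hS.posSemidef hR (matAct S⁻¹ (x - μ))
  rwa [matAct_matAct_inv hS.isUnit, real_inner_comm, ← mahalanobisSq_eq_inner] at h

theorem mul_norm_sq_matAct_inv_le {κ : ℝ} (hS : S.PosDef) (hκ : κ • 1 ≤ S) (v : Ground m) :
    κ * ‖matAct S⁻¹ v‖ ^ 2 ≤ inner ℝ v (matAct S⁻¹ v) := by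
  have h := le_inner_matAct_self hκ (matAct S⁻¹ v)
  rwa [matAct_matAct_inv hS.isUnit, real_inner_comm] at h

theorem mul_inner_matAct_inv_le {κ : ℝ} (hS : S.PosDef) (hκ : κ • 1 ≤ S) (v : Ground m) :
    κ * inner ℝ v (matAct S⁻¹ v) ≤ ‖v‖ ^ 2 := by
  rcases le_total κ 0 with h0 | h0
  · exact (mul_nonpos_of_nonpos_of_nonneg h0 (inner_matAct_self_nonneg hS.inv.posSemidef v)).trans
      (sq_nonneg _)
  have hinv := mul_le_mul_of_nonneg_left (mul_norm_sq_matAct_inv_le hS hκ v) h0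
  have hcs := mul_le_mul_of_nonneg_left (real_inner_le_norm v (matAct S⁻¹ v)) h0
  nlinarith [sq_nonneg (‖v‖ - κ * ‖matAct S⁻¹ v‖)]

theorem mul_norm_matAct_inv_le {κ : ℝ} (hS : S.PosDef) (h0 : 0 ≤ κ) (hκ : κ • 1 ≤ S)
    (v : Ground m) : κ * ‖matAct S⁻¹ v‖ ≤ ‖v‖ := by
  refine le_of_sq_le_sq ?_ (norm_nonneg v)
  calc (κ * ‖matAct S⁻¹ v‖) ^ 2 = κ * (κ * ‖matAct S⁻¹ v‖ ^ 2) := by ring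
    _ ≤ κ * inner ℝ v (matAct S⁻¹ v) :=
        mul_le_mul_of_nonneg_left (mul_norm_sq_matAct_inv_le hS hκ v) h0
    _ ≤ ‖v‖ ^ 2 := mul_inner_matAct_inv_le hS hκ v

theorem mul_mahalanobisSq_le_norm_sq_sub {κ : ℝ} (hS : S.PosDef) (hκ : κ • 1 ≤ S)
    (μ x : Ground m) : κ * mahalanobisSq μ S x ≤ ‖x - μ‖ ^ 2 := by
  rw [mahalanobisSq_eq_inner]; exact mul_inner_matAct_inv_le hS hκ _

theorem posSemidef_one_sub_smul_inv {c : ℝ} (hS : S.PosDef) (hc : c • 1 ≤ S) :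
    (1 - c • S⁻¹).PosSemidef := by
  have hherm : (1 - c • S⁻¹).IsHermitian :=
    Matrix.isHermitian_one.sub (hS.inv.1.smul (.all c))
  refine .of_dotProduct_mulVec_nonneg hherm fun v => ?_
  have hform := mul_inner_matAct_inv_le hS hc (WithLp.toLp 2 v)
  rw [star_trivial, ← inner_matAct _ (WithLp.toLp 2 v) (WithLp.toLp 2 v), sub_matAct, one_matAct,
    smul_matAct, inner_sub_right, inner_smul_right, real_inner_self_eq_norm_sq]
  exact sub_nonneg.2 hform

theorem mahalanobisSq_anti (hS : S.PosDef) (hS' : S'.PosDef) (h : S ≤ S') (μ x : Ground m) :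
    mahalanobisSq μ S' x ≤ mahalanobisSq μ S x := by
  simp only [mahalanobisSq_eq_inner]
  generalize x - μ = v
  set w := matAct S'⁻¹ v with hw
  have hSw : inner ℝ (matAct S⁻¹ v) (matAct S w) = inner ℝ v w := by
    rw [← inner_matAct_left_of_isHermitian hS.1, matAct_matAct_inv hS.isUnit]
  have hle : inner ℝ w (matAct S w) ≤ inner ℝ v w := by
    have := inner_matAct_self_mono h w
    rwa [hw, matAct_matAct_inv hS'.isUnit, ← hw, real_inner_comm v] at this
  have hsq := inner_matAct_self_nonneg hS.posSemidef (w - matAct S⁻¹ v)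
  rw [matAct_sub, matAct_matAct_inv hS.isUnit, inner_sub_right, inner_sub_left, inner_sub_left,
    hSw, real_inner_comm v, real_inner_comm v] at hsq
  linarith

theorem mahalanobisSq_le_two_mul_add (hS : S.PosDef) (μ x y : Ground m) :
    mahalanobisSq μ S x ≤ 2 * mahalanobisSq μ S y + 2 * mahalanobisSq y S x := by
  have h := inner_matAct_self_nonneg hS.inv.posSemidef ((y - μ) - (x - y))
  simp only [mahalanobisSq_eq_inner]
  rw [← sub_add_sub_cancel' y μ x]
  simp only [matAct_sub, matAct_add, inner_sub_right, inner_sub_left, inner_add_left,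
    inner_add_right] at h ⊢
  linarith

end LinearAlgebra

section Contractions

theorem exists_contractingWith_of_norm_sq_le {E : Type*} [NormedAddCommGroup E] {f : E → E}
    {a : ℝ} (ha : a < 1) (h : ∀ x y, ‖f x - f y‖ ^ 2 ≤ a * ‖x - y‖ ^ 2) :
    ∃ q : NNReal, ContractingWith q f := by
  have hsqrt : a ≤ √a ^ 2 := by rw [Real.sq_sqrt']; exact le_max_left a 0
  refine ⟨(√a).toNNReal, ?_, LipschitzWith.of_dist_le_mul fun x y => ?_⟩
  · simpa [Real.toNNReal_lt_one] using (Real.sqrt_lt' one_pos).2 (by simpa using ha)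
  · rw [dist_eq_norm, dist_eq_norm, Real.coe_toNNReal _ (Real.sqrt_nonneg a)]
    refine le_of_sq_le_sq ?_ (by positivity)
    rw [mul_pow]
    exact (h x y).trans (mul_le_mul_of_nonneg_right hsqrt (sq_nonneg _))

namespace GaussianMixture

variable {m K : ℕ} (G : GaussianMixture m K)

theorem daeAffine_mean (t : ℝ) (k : Fin K) : G.daeAffine t k (G.mean k) = G.mean k := by
  simp [daeAffine]

theorem contAffine_mean (t : ℝ) (k : Fin K) : G.contAffine t k (G.mean k) = G.mean k := by
  simp [contAffine]

theorem smul_one_le_cov {t : ℝ} {k : Fin K} (h : (G.contCov t k).PosSemidef) :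
    (2 * t) • 1 ≤ G.cov k :=
  Matrix.le_iff.2 h

theorem exists_contractingWith_daeAffine {t : ℝ} (ht : 0 < t) (k : Fin K) :
    ∃ q : NNReal, ContractingWith q (G.daeAffine t k) := by
  have hS := G.cov_posDef k
  obtain ⟨c, hc, hcS⟩ := exists_pos_smul_one_le hS.inv
  have hpos : 0 < 1 + 2 * t * c := by positivity
  refine exists_contractingWith_of_norm_sq_le (a := (1 + 2 * t * c)⁻¹)
    (inv_lt_one_of_one_lt₀ (by linarith [mul_pos ht hc])) fun x y => ?_
  have hsub : G.daeAffine t k x - G.daeAffine t k y = matAct (1 + t • (G.cov k)⁻¹)⁻¹ (x - y) := by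
    simp only [daeAffine, matAct_sub]; abel
  set w := matAct (1 + t • (G.cov k)⁻¹)⁻¹ (x - y) with hw
  have hxy : x - y = w + t • matAct (G.cov k)⁻¹ w := by
    rw [← matAct_matAct_inv (posDef_one_add_smul_inv hS ht.le).isUnit (x - y), ← hw, add_matAct,
      smul_matAct, one_matAct]
  have hform := mul_le_mul_of_nonneg_left (le_inner_matAct_self hcS w) ht.le
  rw [hsub, hxy, norm_add_sq_real, inner_smul_right, inv_mul_eq_div, le_div_iff₀ hpos]
  nlinarith [sq_nonneg ‖t • matAct (G.cov k)⁻¹ w‖]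

theorem exists_contractingWith_contAffine {t : ℝ} (ht : 0 < t) (k : Fin K)
    (h : (G.contCov t k).PosSemidef) : ∃ q : NNReal, ContractingWith q (G.contAffine t k) := by
  have hS := G.cov_posDef k
  have hA := posSemidef_one_sub_smul_inv hS (G.smul_one_le_cov h)
  obtain ⟨c, hc, hcS⟩ := exists_pos_smul_one_le hS.inv
  refine exists_contractingWith_of_norm_sq_le (a := 1 - 2 * t * c)
    (by linarith [mul_pos ht hc]) fun x y => ?_
  have hsub : G.contAffine t k x - G.contAffine t k y
      = matAct (CFC.sqrt (1 - (2 * t) • (G.cov k)⁻¹)) (x - y) := by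
    simp only [contAffine, matAct_sub]; abel
  have hform := mul_le_mul_of_nonneg_left (le_inner_matAct_self hcS (x - y)) ht.le
  rw [hsub, norm_sq_matAct_sqrt hA, sub_matAct, smul_matAct, one_matAct, inner_sub_right,
    inner_smul_right, real_inner_self_eq_norm_sq]
  linarith

end GaussianMixture

end Contractions

/-! ### Gaussian densities and mixtures -/

section GaussianDensity

theorem eq_of_withDensity_ofReal_eq {X : Type*} [TopologicalSpace X] [MeasurableSpace X]
    [OpensMeasurableSpace X] {ν : Measure X} [SigmaFinite ν] [ν.IsOpenPosMeasure] {f g : X → ℝ}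
    (hf : Continuous f) (hg : Continuous g) (hf0 : ∀ x, 0 ≤ f x) (hg0 : ∀ x, 0 ≤ g x)
    (h : ν.withDensity (fun x => ENNReal.ofReal (f x))
      = ν.withDensity (fun x => ENNReal.ofReal (g x))) : f = g := by
  have hae := (withDensity_eq_iff_of_sigmaFinite hf.measurable.ennreal_ofReal.aemeasurable
    hg.measurable.ennreal_ofReal.aemeasurable).1 h
  refine (hf.ae_eq_iff_eq ν hg).1 (hae.mono fun x hx => ?_)
  exact (ENNReal.ofReal_eq_ofReal_iff (hf0 x) (hg0 x)).1 hx

variable {m : ℕ} {S S' : Matrix (Fin m) (Fin m) ℝ}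

@[fun_prop] theorem continuous_gaussianDensity (μ : Ground m) (S : Matrix (Fin m) (Fin m) ℝ) :
    Continuous (gaussianDensity μ S) := by
  unfold gaussianDensity; fun_prop

theorem gaussianDensity_pos (μ : Ground m) (hS : S.PosDef) (x : Ground m) :
    0 < gaussianDensity μ S x := by
  have := hS.det_pos
  unfold gaussianDensity; positivity

theorem gaussianDensity_le (hS : S.PosDef) (μ x : Ground m) :
    gaussianDensity μ S x ≤ (√((2 * Real.pi) ^ m * S.det))⁻¹ :=
  mul_le_of_le_one_right (by positivity)
    (Real.exp_le_one_iff.2 (by linarith [mahalanobisSq_nonneg hS μ x]))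

theorem gaussianDensity_zero_one (x : Ground m) :
    gaussianDensity 0 (1 : Matrix (Fin m) (Fin m) ℝ) x
      = (√((2 * Real.pi) ^ m))⁻¹ * Real.exp (-(1 / 2) * ‖x‖ ^ 2) := by
  simp [gaussianDensity, mahalanobisSq_eq_inner]

theorem integrable_gaussianDensity_zero_one :
    Integrable (gaussianDensity (0 : Ground m) 1) := by
  have hexp := (GaussianFourier.integrable_cexp_neg_mul_sq_norm_add (V := Ground m)
    (b := (1 / 2 : ℂ)) (by norm_num) 0 0).norm
  rw [funext gaussianDensity_zero_one]
  refine Integrable.const_mul (hexp.congr (.of_forall fun x => ?_)) _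
  simp only [Complex.norm_exp]
  congr 1
  simp [← Complex.ofReal_pow]

theorem integral_gaussianDensity_zero_one_mul_cexp (ξ : Ground m) :
    ∫ x : Ground m, (gaussianDensity 0 1 x : ℂ) * Complex.exp (inner ℝ x ξ * Complex.I)
      = Complex.exp (-(‖ξ‖ ^ 2 / 2)) := by
  have hfourier := GaussianFourier.integral_cexp_neg_mul_sq_norm_add (V := Ground m)
    (b := (1 / 2 : ℂ)) (by norm_num) Complex.I ξ
  have hintegrand (x : Ground m) :
      (gaussianDensity 0 1 x : ℂ) * Complex.exp (inner ℝ x ξ * Complex.I)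
        = ((√((2 * Real.pi) ^ m))⁻¹ : ℝ)
          * Complex.exp (-(1 / 2 : ℂ) * ‖x‖ ^ 2 + Complex.I * inner ℝ ξ x) := by
    rw [gaussianDensity_zero_one, Complex.exp_add, Complex.ofReal_mul, Complex.ofReal_exp,
      mul_assoc, real_inner_comm, mul_comm Complex.I]
    push_cast; rfl
  have hnormalization : (Real.pi / (1 / 2) : ℂ) ^ ((Module.finrank ℝ (Ground m) : ℂ) / 2)
      = (√((2 * Real.pi) ^ m) : ℝ) := by
    rw [Real.sqrt_eq_rpow, ← Real.rpow_natCast, ← Real.rpow_mul (by positivity),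
      Complex.ofReal_cpow (by positivity)]
    congr 1
    · push_cast; ring
    · simp; ring
  have hne : √((2 * Real.pi) ^ m) ≠ 0 := by positivity
  simp_rw [hintegrand]
  rw [integral_const_mul, hfourier, hnormalization, ← mul_assoc, ← Complex.ofReal_mul,
    inv_mul_cancel₀ hne, Complex.ofReal_one, one_mul, Complex.I_sq]
  congr 1; ring

theorem stdGaussian_eq_withDensity : stdGaussian (Ground m) =
    volume.withDensity (fun x => ENNReal.ofReal (gaussianDensity 0 1 x)) := by
  have := isFiniteMeasure_withDensity_ofReal (integrable_gaussianDensity_zero_one (m := m)).2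
  refine Measure.ext_of_charFun (funext fun ξ => ?_)
  have htoReal (x : Ground m) :
      (ENNReal.ofReal (gaussianDensity 0 1 x)).toReal = gaussianDensity 0 1 x :=
    ENNReal.toReal_ofReal (gaussianDensity_pos 0 Matrix.PosDef.one x).le
  rw [charFun_stdGaussian, charFun_apply, integral_withDensity_eq_integral_toReal_smul
    (by fun_prop) (by simp)]
  simp only [htoReal, Complex.real_smul, integral_gaussianDensity_zero_one_mul_cexp]
  congr 1; ring

theorem multivariateGaussian_eq_map (μ : Ground m) (S : Matrix (Fin m) (Fin m) ℝ) :
    multivariateGaussian μ S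
      = (stdGaussian (Ground m)).map (fun x => μ + matAct (CFC.sqrt S) x) := rfl

theorem map_volume_add_matAct (b : Ground m) {A : Matrix (Fin m) (Fin m) ℝ} (hA : A.det ≠ 0) :
    (volume : Measure (Ground m)).map (fun x => b + matAct A x)
      = ENNReal.ofReal |A.det⁻¹| • volume := by
  have hdet : LinearMap.det (Matrix.toLpLin 2 2 A) = A.det := LinearMap.det_toLpLin _ _
  have hlin := Measure.map_linearMap_addHaar_eq_smul_addHaar (volume : Measure (Ground m))
    (f := Matrix.toLpLin 2 2 A) (by rwa [hdet])
  rw [hdet] at hlin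
  change volume.map ((fun x => b + x) ∘ Matrix.toLpLin 2 2 A) = _
  rw [← Measure.map_map (by fun_prop) (by exact measurable_matAct A), hlin, Measure.map_smul,
    map_add_left_eq_self]

theorem gaussianDensity_zero_one_eq (hS : S.PosDef) (μ x : Ground m) :
    gaussianDensity 0 (1 : Matrix (Fin m) (Fin m) ℝ) x
      = √S.det * gaussianDensity μ S (μ + matAct (CFC.sqrt S) x) := by
  have := hS.det_pos
  rw [gaussianDensity_zero_one, gaussianDensity, mahalanobisSq_add_matAct_sqrt hS,
    Real.sqrt_mul (by positivity)]
  field_simp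

theorem multivariateGaussian_eq_withDensity (μ : Ground m) (hS : S.PosDef) :
    multivariateGaussian μ S =
      volume.withDensity (fun x => ENNReal.ofReal (gaussianDensity μ S x)) := by
  have hd : 0 < √S.det := Real.sqrt_pos.2 hS.det_pos
  have hdet : (CFC.sqrt S).det = √S.det := by rw [hS.posSemidef.det_sqrt, RCLike.sqrt_real]
  have hmeas : Measurable (fun x => μ + matAct (CFC.sqrt S) x) := by fun_prop
  have hmap := map_volume_add_matAct μ (hdet ▸ hd.ne')
  rw [hdet, abs_of_pos (inv_pos.2 hd)] at hmap
  refine Measure.ext_of_lintegral _ fun f hf => ?_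
  set p : Ground m → ℝ≥0∞ := fun x => ENNReal.ofReal (gaussianDensity μ S x) with hp
  have hpm : Measurable p := by fun_prop
  calc ∫⁻ x, f x ∂multivariateGaussian μ S
      = ∫⁻ x, ENNReal.ofReal (gaussianDensity 0 1 x) * f (μ + matAct (CFC.sqrt S) x) := by
        rw [multivariateGaussian_eq_map, lintegral_map hf hmeas, stdGaussian_eq_withDensity,
          lintegral_withDensity_eq_lintegral_mul _ (by fun_prop) (by exact hf.comp hmeas)]
        rfl
    _ = ENNReal.ofReal √S.det * ∫⁻ x, (p * f) (μ + matAct (CFC.sqrt S) x) := by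
        rw [← lintegral_const_mul _ (by exact (hpm.mul hf).comp hmeas)]
        simp only [gaussianDensity_zero_one_eq hS μ, ENNReal.ofReal_mul hd.le, mul_assoc, hp,
          Pi.mul_apply]
    _ = ∫⁻ x, (p * f) x := by
        rw [← lintegral_map (hpm.mul hf) hmeas, hmap, lintegral_smul_measure, smul_eq_mul,
          ← mul_assoc, ← ENNReal.ofReal_mul hd.le, mul_inv_cancel₀ hd.ne', ENNReal.ofReal_one,
          one_mul]
    _ = _ := (lintegral_withDensity_eq_lintegral_mul _ hpm hf).symm

theorem multivariateGaussian_conv (μ ν : Ground m) (hS : S.PosSemidef) (hS' : S'.PosSemidef) :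
    multivariateGaussian μ S ∗ multivariateGaussian ν S'
      = multivariateGaussian (μ + ν) (S + S') := by
  refine Measure.ext_of_charFun (funext fun ξ => ?_)
  rw [charFun_conv, charFun_multivariateGaussian hS, charFun_multivariateGaussian hS',
    charFun_multivariateGaussian (hS.add hS'), ← Complex.exp_add, Matrix.add_mulVec,
    dotProduct_add, inner_add_right]
  congr 1
  push_cast; ring

theorem integrable_gaussianDensity_sub (hS : S.PosDef) (μ : Ground m) (P : Measure (Ground m))
    [IsFiniteMeasure P] (x : Ground m) : Integrable (fun y => gaussianDensity μ S (x - y)) P := by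
  refine .of_bound (C := (√((2 * Real.pi) ^ m * S.det))⁻¹) (by fun_prop) (.of_forall fun y => ?_)
  rw [Real.norm_of_nonneg (gaussianDensity_pos _ hS _).le]
  exact gaussianDensity_le hS _ _

theorem continuous_integral_gaussianDensity_sub (hS : S.PosDef) (μ : Ground m)
    (P : Measure (Ground m)) [IsFiniteMeasure P] :
    Continuous fun x => ∫ y, gaussianDensity μ S (x - y) ∂P := by
  refine continuous_of_dominated (bound := fun _ => (√((2 * Real.pi) ^ m * S.det))⁻¹)
    (fun x => by fun_prop) (fun x => .of_forall fun y => ?_) (integrable_const _)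
    (.of_forall fun y => by fun_prop)
  rw [Real.norm_of_nonneg (gaussianDensity_pos _ hS _).le]
  exact gaussianDensity_le hS _ _

theorem integral_gaussianDensity_sub (μ ν : Ground m) (hS : S.PosDef) (hS' : S'.PosDef)
    (x : Ground m) : ∫ y, gaussianDensity ν S' (x - y) ∂(multivariateGaussian μ S)
      = gaussianDensity (μ + ν) (S + S') x := by
  have hconv := multivariateGaussian_conv μ ν hS.posSemidef hS'.posSemidef
  have hlconv : ((fun x => ENNReal.ofReal (gaussianDensity μ S x)) ⋆ₗ
        fun x => ENNReal.ofReal (gaussianDensity ν S' x))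
      = fun x => ENNReal.ofReal
        (∫ y, gaussianDensity ν S' (x - y) ∂(multivariateGaussian μ S)) := by
    ext x
    rw [lconvolution_def, ofReal_integral_eq_lintegral_ofReal
      (integrable_gaussianDensity_sub hS' ν _ x)
      (.of_forall fun y => (gaussianDensity_pos _ hS' _).le),
      multivariateGaussian_eq_withDensity μ hS,
      lintegral_withDensity_eq_lintegral_mul _ (by fun_prop) (by fun_prop)]
    refine lintegral_congr fun y => ?_
    rw [Pi.mul_apply, neg_add_eq_sub]
  rw [multivariateGaussian_eq_withDensity μ hS, multivariateGaussian_eq_withDensity ν hS',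
    multivariateGaussian_eq_withDensity _ (hS.add hS'),
    conv_withDensity_eq_lconvolution (by fun_prop) (by fun_prop), hlconv] at hconv
  exact congrFun (eq_of_withDensity_ofReal_eq (continuous_integral_gaussianDensity_sub hS' ν _)
    (by fun_prop) (fun x => integral_nonneg fun y => (gaussianDensity_pos _ hS' _).le)
    (fun x => (gaussianDensity_pos _ (hS.add hS') x).le) hconv) x

theorem heatKernel_half {t : ℝ} (ht : 0 < t) (z : Ground m) :
    heatKernel (t / 2) z = gaussianDensity 0 (t • (1 : Matrix (Fin m) (Fin m) ℝ)) z := by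
  have hinv : (t • (1 : Matrix (Fin m) (Fin m) ℝ))⁻¹ = t⁻¹ • 1 :=
    Matrix.inv_eq_right_inv (by simp [smul_smul, inv_mul_cancel₀ ht.ne'])
  rw [heatKernel, gaussianDensity, mahalanobisSq_eq_inner, hinv, sub_zero,
    inner_smul_one_matAct_self]
  congr 1
  · rw [Matrix.det_smul, Matrix.det_one, mul_one, Fintype.card_fin, ← mul_pow,
      Real.sqrt_eq_rpow, ← Real.rpow_natCast, ← Real.rpow_mul (by positivity),
      ← Real.rpow_neg (by positivity)]
    congr 1 <;> ring
  · congr 1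
    field_simp
    norm_num

theorem hasFDerivAt_mahalanobisSq (μ : Ground m) (hS : S.IsHermitian) (x : Ground m) :
    HasFDerivAt (mahalanobisSq μ S) ((2 : ℝ) • innerSL ℝ (matAct S⁻¹ (x - μ))) x := by
  have hsub := (hasFDerivAt_id (𝕜 := ℝ) x).sub_const μ
  have hinner := hsub.inner ℝ ((Matrix.toEuclideanCLM (𝕜 := ℝ) S⁻¹).hasFDerivAt.comp x hsub)
  rw [funext (mahalanobisSq_eq_inner μ S)]
  refine hinner.congr_fderiv (ContinuousLinearMap.ext fun v => ?_)
  simp only [ContinuousLinearMap.comp_apply, ContinuousLinearMap.prod_apply, fderivInnerCLM_apply,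
    smul_apply, innerSL_apply_apply, ContinuousLinearMap.id_apply, id_eq,
    ← matAct_eq_toEuclideanCLM]
  change inner ℝ (x - μ) (matAct S⁻¹ v) + inner ℝ v (matAct S⁻¹ (x - μ)) = _
  rw [← inner_matAct_left_of_isHermitian hS.inv, real_inner_comm _ v, smul_eq_mul, two_mul]

theorem hasFDerivAt_gaussianDensity (μ : Ground m) (hS : S.IsHermitian) (x : Ground m) :
    HasFDerivAt (gaussianDensity μ S)
      (gaussianDensity μ S x • innerSL ℝ (-matAct S⁻¹ (x - μ))) x := by
  have h := ((hasFDerivAt_mahalanobisSq μ hS x).const_mul (-(1 / 2))).exp.const_mul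
    (√((2 * Real.pi) ^ m * S.det))⁻¹
  refine h.congr_fderiv (ContinuousLinearMap.ext fun v => ?_)
  simp [gaussianDensity]
  ring

theorem map_multivariateGaussian_matAct_add (μ b : Ground m) (hS : S.PosSemidef)
    (A : Matrix (Fin m) (Fin m) ℝ) :
    (multivariateGaussian μ S).map (fun x => matAct A x + b)
      = multivariateGaussian (matAct A μ + b) (A * S * Aᵀ) := by
  have hA : Measurable (matAct A) := measurable_matAct A
  have hASA : (A * S * Aᵀ).PosSemidef := by simpa using hS.mul_mul_conjTranspose_same A
  have := Measure.isProbabilityMeasure_map (μ := multivariateGaussian μ S) hA.aemeasurable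
  have := Measure.isProbabilityMeasure_map (μ := multivariateGaussian μ S)
    (hA.add_const b).aemeasurable
  refine Measure.ext_of_charFun (funext fun ξ => ?_)
  have hlin : charFun ((multivariateGaussian μ S).map (matAct A)) ξ
      = charFun (multivariateGaussian μ S) (matAct Aᵀ ξ) := by
    rw [charFun_apply, charFun_apply, integral_map hA.aemeasurable (by fun_prop)]
    simp only [inner_matAct_left]
  have hform : (matAct Aᵀ ξ).ofLp ⬝ᵥ S *ᵥ (matAct Aᵀ ξ).ofLp
      = ξ.ofLp ⬝ᵥ (A * S * Aᵀ) *ᵥ ξ.ofLp := by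
    rw [← inner_matAct, ← inner_matAct, inner_matAct_left, mul_matAct, mul_matAct,
      Matrix.transpose_transpose]
  change charFun ((multivariateGaussian μ S).map ((fun x => x + b) ∘ matAct A)) ξ = _
  rw [← Measure.map_map (by fun_prop) hA, charFun_map_add_const, hlin,
    charFun_multivariateGaussian hS, charFun_multivariateGaussian hASA, ← Complex.exp_add, hform,
    inner_matAct_left, Matrix.transpose_transpose, inner_add_right, real_inner_comm b]
  congr 1
  push_cast; ring

theorem multivariateGaussian_mahalanobisSq_gt (μ : Ground m) (hS : S.PosDef) {r : ℝ}
    (hr : 0 ≤ r) : multivariateGaussian μ S {x | r ^ 2 < mahalanobisSq μ S x}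
      = stdGaussian (Ground m) {x | r < ‖x‖} := by
  rw [multivariateGaussian_eq_map, Measure.map_apply (by fun_prop)
    (measurableSet_lt (by fun_prop) (by fun_prop))]
  congr 1
  ext z
  rw [mem_preimage, mem_ofPred_eq, mahalanobisSq_add_matAct_sqrt hS]
  exact pow_lt_pow_iff_left₀ hr (norm_nonneg z) two_ne_zero

theorem exists_measure_norm_gt_le {E : Type*} [NormedAddCommGroup E] [ProperSpace E]
    [MeasurableSpace E] [BorelSpace E] (P : Measure E) [IsFiniteMeasure P] {ε : ℝ≥0∞}
    (hε : 0 < ε) : ∃ r : ℝ, 0 < r ∧ P {x | r < ‖x‖} ≤ ε := by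
  have hlim := tendsto_measure_norm_gt_of_isTightMeasureSet (isTightMeasureSet_singleton (μ := P))
  simp only [mem_singleton_iff, iSup_iSup_eq_left] at hlim
  obtain ⟨r, hr, hr0⟩ :=
    ((hlim.eventually_le_const hε).and (Filter.eventually_gt_atTop 0)).exists
  exact ⟨r, hr0, hr⟩

end GaussianDensity

section Mixture

variable {m K : ℕ}

theorem integral_gaussianSum {E : Type*} [NormedAddCommGroup E] [NormedSpace ℝ E]
    {π : Fin K → ℝ} {μ : Fin K → Ground m} {S : Fin K → Matrix (Fin m) (Fin m) ℝ}
    (hπ : ∀ k, 0 ≤ π k) {f : Ground m → E}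
    (hf : ∀ k, Integrable f (multivariateGaussian (μ k) (S k))) :
    ∫ x, f x ∂(gaussianSum π μ S)
      = ∑ k, π k • ∫ x, f x ∂(multivariateGaussian (μ k) (S k)) := by
  rw [gaussianSum, integral_finsetSum_measure
    fun k _ => (hf k).smul_measure ENNReal.ofReal_ne_top]
  refine Finset.sum_congr rfl fun k _ => ?_
  rw [integral_smul_measure, ENNReal.toReal_ofReal (hπ k)]

namespace GaussianMixture

variable (G : GaussianMixture m K) {S : Fin K → Matrix (Fin m) (Fin m) ℝ}

/-- The density `x ↦ ∑ₖ πₖ N(x; μₖ, Sₖ)` of `∑ₖ πₖ N(μₖ, Sₖ)`, with the weights and centers of the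
mixture `G` but arbitrary covariances `Sₖ`. -/
noncomputable def mixDensity (S : Fin K → Matrix (Fin m) (Fin m) ℝ) (x : Ground m) : ℝ :=
  ∑ k, G.weight k * gaussianDensity (G.mean k) (S k) x

theorem weight_le_one (k : Fin K) : G.weight k ≤ 1 := by
  rw [← G.weight_sum]
  exact Finset.single_le_sum (fun j _ => G.weight_nonneg j) (Finset.mem_univ k)

theorem weight_mul_gaussianDensity_nonneg (hS : ∀ k, (S k).PosDef) (k : Fin K) (x : Ground m) :
    0 ≤ G.weight k * gaussianDensity (G.mean k) (S k) x :=
  mul_nonneg (G.weight_nonneg k) (gaussianDensity_pos _ (hS k) x).le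

theorem mixDensity_pos (hS : ∀ k, (S k).PosDef) (x : Ground m) : 0 < G.mixDensity S x := by
  obtain ⟨k, -, hk⟩ := Finset.exists_lt_of_sum_lt (s := Finset.univ) (f := fun _ => (0 : ℝ))
    (g := G.weight) (by simp [G.weight_sum])
  exact Finset.sum_pos' (fun j _ => G.weight_mul_gaussianDensity_nonneg hS j x)
    ⟨k, Finset.mem_univ k, mul_pos hk (gaussianDensity_pos _ (hS k) x)⟩

theorem continuous_mixDensity (S : Fin K → Matrix (Fin m) (Fin m) ℝ) :
    Continuous (G.mixDensity S) := by
  unfold mixDensity; fun_prop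

theorem resp_eq (S : Fin K → Matrix (Fin m) (Fin m) ℝ) (k : Fin K) (x : Ground m) :
    G.resp S k x = G.weight k * gaussianDensity (G.mean k) (S k) x / G.mixDensity S x := rfl

theorem resp_nonneg (hS : ∀ k, (S k).PosDef) (k : Fin K) (x : Ground m) : 0 ≤ G.resp S k x :=
  div_nonneg (G.weight_mul_gaussianDensity_nonneg hS k x) (G.mixDensity_pos hS x).le

theorem sum_resp (hS : ∀ k, (S k).PosDef) (x : Ground m) : ∑ k, G.resp S k x = 1 := by
  simp only [resp_eq, ← Finset.sum_div]
  exact div_self (G.mixDensity_pos hS x).ne'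

theorem resp_le_one (hS : ∀ k, (S k).PosDef) (k : Fin K) (x : Ground m) : G.resp S k x ≤ 1 := by
  rw [← G.sum_resp hS x]
  exact Finset.single_le_sum (fun j _ => G.resp_nonneg hS j x) (Finset.mem_univ k)

theorem gaussianSum_eq_withDensity (hS : ∀ k, (S k).PosDef) :
    gaussianSum G.weight G.mean S
      = volume.withDensity (fun x => ENNReal.ofReal (G.mixDensity S x)) := by
  have hsum (x : Ground m) : ENNReal.ofReal (G.mixDensity S x)
      = ∑ k, ENNReal.ofReal (G.weight k) *
        ENNReal.ofReal (gaussianDensity (G.mean k) (S k) x) := by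
    rw [mixDensity, ENNReal.ofReal_sum_of_nonneg fun j _ =>
      G.weight_mul_gaussianDensity_nonneg hS j x]
    exact Finset.sum_congr rfl fun k _ => ENNReal.ofReal_mul (G.weight_nonneg k)
  ext A hA
  simp_rw [hsum]
  rw [withDensity_apply _ hA, gaussianSum, Measure.finsetSum_apply,
    lintegral_finsetSum _ fun k _ => by fun_prop]
  refine Finset.sum_congr rfl fun k _ => ?_
  rw [Measure.smul_apply, multivariateGaussian_eq_withDensity _ (hS k), withDensity_apply _ hA,
    lintegral_const_mul _ (by fun_prop), smul_eq_mul]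

instance isProbabilityMeasure_gaussianSum :
    IsProbabilityMeasure (gaussianSum G.weight G.mean S) where
  measure_univ := by
    simp only [gaussianSum, Measure.finsetSum_apply, Measure.smul_apply, measure_univ,
      smul_eq_mul, mul_one]
    rw [← ENNReal.ofReal_sum_of_nonneg fun j _ => G.weight_nonneg j, G.weight_sum,
      ENNReal.ofReal_one]

instance isProbabilityMeasure_law : IsProbabilityMeasure G.law :=
  G.isProbabilityMeasure_gaussianSum

theorem heatConv_law {t : ℝ} (ht : 0 < t) :
    heatConv (t / 2) G.law = G.mixDensity (G.noisyCov t) := by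
  ext x
  have htI : (t • (1 : Matrix (Fin m) (Fin m) ℝ)).PosDef := Matrix.PosDef.one.smul ht
  simp only [heatConv, heatKernel_half ht]
  rw [law, integral_gaussianSum G.weight_nonneg fun k => integrable_gaussianDensity_sub htI _ _ x]
  refine Finset.sum_congr rfl fun k _ => ?_
  rw [integral_gaussianDensity_sub _ _ (G.cov_posDef k) htI, add_zero, smul_eq_mul, noisyCov]

theorem score_mixDensity (hS : ∀ k, (S k).PosDef) (x : Ground m) :
    score (G.mixDensity S) x = -∑ k, G.resp S k x • matAct (S k)⁻¹ (x - G.mean k) := by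
  have hmix : HasFDerivAt (G.mixDensity S) (∑ k, G.weight k •
      (gaussianDensity (G.mean k) (S k) x • innerSL ℝ (-matAct (S k)⁻¹ (x - G.mean k)))) x :=
    HasFDerivAt.fun_sum fun k _ => (hasFDerivAt_gaussianDensity _ (hS k).1 x).const_mul _
  have hlog := hmix.log (G.mixDensity_pos hS x).ne'
  refine HasGradientAt.gradient (hasGradientAt_iff_hasFDerivAt.2 (hlog.congr_fderiv ?_))
  ext v
  simp only [resp_eq, InnerProductSpace.toDual_apply_apply, smul_apply, sum_apply,
    innerSL_apply_apply, inner_neg_left, sum_inner, inner_smul_left, smul_eq_mul, Finset.mul_sum]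
  rw [← Finset.sum_neg_distrib]
  refine Finset.sum_congr rfl fun k _ => ?_
  simp only [conj_trivial]
  ring

end GaussianMixture

end Mixture

section Real

theorem pow_mul_exp_neg_le_factorial {x : ℝ} (hx : 0 ≤ x) (n : ℕ) :
    x ^ n * Real.exp (-x) ≤ n.factorial := by
  have h := Real.pow_div_factorial_le_exp x hx n
  rw [div_le_iff₀ (by positivity)] at h
  rw [Real.exp_neg, ← div_eq_mul_inv, div_le_iff₀ (Real.exp_pos x)]
  linarith

theorem mul_pow_le_of_sq_le_mul_exp_neg {γ a ε Q D t : ℝ} {n : ℕ} (hε : 0 ≤ ε) (hQ : 0 ≤ Q)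
    (ht : 0 ≤ t) (hD : 0 ≤ D) (hγε : γ ^ (2 * n) ≤ ε) (hγ : γ ^ 2 ≤ Q * Real.exp (-D))
    (ha : a ^ 2 ≤ t * D) :
    (γ * a) ^ (2 * n + 2) ≤ ε * (Q * t ^ (n + 1) * (n + 1).factorial) :=
  calc (γ * a) ^ (2 * n + 2) = γ ^ (2 * n) * γ ^ 2 * (a ^ 2) ^ (n + 1) := by ring
    _ ≤ ε * (Q * Real.exp (-D)) * (t * D) ^ (n + 1) := by gcongr
    _ = ε * (Q * t ^ (n + 1) * (D ^ (n + 1) * Real.exp (-D))) := by ring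
    _ ≤ ε * (Q * t ^ (n + 1) * (n + 1).factorial) := by
      have := pow_mul_exp_neg_le_factorial hD (n + 1)
      gcongr

theorem eventually_mul_le (A : ℝ) {a : ℝ} (ha : 0 < a) : ∀ᶠ ε in 𝓝[>] (0 : ℝ), ε * A ≤ a := by
  have h : Filter.Tendsto (fun ε : ℝ => ε * A) (𝓝 0) (𝓝 0) := by
    simpa using (continuous_mul_const A).tendsto 0
  exact (h.mono_left nhdsWithin_le_nhds).eventually_le_const ha

end Real

section Responsibilities

variable {m K : ℕ}

theorem gaussianDensity_sq (μ : Ground m) {S : Matrix (Fin m) (Fin m) ℝ} (hS : S.PosDef)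
    (x : Ground m) : gaussianDensity μ S x ^ 2
      = ((2 * Real.pi) ^ m * S.det)⁻¹ * Real.exp (-mahalanobisSq μ S x) := by
  have hdet := hS.det_pos
  rw [gaussianDensity, mul_pow, inv_pow, Real.sq_sqrt (by positivity), ← Real.exp_nat_mul]
  congr 2
  push_cast
  ring

namespace GaussianMixture

variable (G : GaussianMixture m K) {S : Fin K → Matrix (Fin m) (Fin m) ℝ}

/-- The square of the ratio `πⱼ N(μⱼ; μⱼ, Sⱼ) / (πₖ N(μₖ; μₖ, Sₖ))` of the peak heights of two
weighted components; it compares their responsibilities. Taking squares avoids the square roots of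
determinants in the Gaussian densities. -/
noncomputable def peakRatioSq (S : Fin K → Matrix (Fin m) (Fin m) ℝ) (j k : Fin K) : ℝ :=
  G.weight j ^ 2 * (S k).det / (G.weight k ^ 2 * (S j).det)

theorem peakRatioSq_nonneg (hS : ∀ k, (S k).PosDef) (j k : Fin K) : 0 ≤ G.peakRatioSq S j k := by
  have hj := (hS j).det_pos
  have hk := (hS k).det_pos
  unfold peakRatioSq
  positivity

theorem peakRatioSq_le (hS : ∀ k, (S k).PosDef) {κ R w : ℝ} (hκ : 0 < κ) (hw : 0 < w)
    {j k : Fin K} (hj : κ • 1 ≤ S j) (hk : S k ≤ R • 1) (hwk : w ≤ G.weight k) :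
    G.peakRatioSq S j k ≤ (R / κ) ^ m / w ^ 2 := by
  have hdetj := pow_le_det hκ.le (hS j).1 hj
  have hdetk := det_le_pow (hS k).posSemidef hk
  have hk0 := (hS k).det_pos
  have hwj := pow_le_one₀ (n := 2) (G.weight_nonneg j) (G.weight_le_one j)
  calc G.peakRatioSq S j k ≤ 1 * R ^ m / (w ^ 2 * κ ^ m) := by
        unfold peakRatioSq
        gcongr
        simpa only [one_mul] using hk0.le.trans hdetk
    _ = (R / κ) ^ m / w ^ 2 := by rw [div_pow]; field_simp

theorem resp_sq_eq (hS : ∀ k, (S k).PosDef) (j : Fin K) {k : Fin K} (hk : G.weight k ≠ 0)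
    (x : Ground m) :
    G.resp S j x ^ 2 = G.peakRatioSq S j k *
      Real.exp (mahalanobisSq (G.mean k) (S k) x - mahalanobisSq (G.mean j) (S j) x) *
        G.resp S k x ^ 2 := by
  have hdetj := (hS j).det_pos.ne'
  have hdetk := (hS k).det_pos.ne'
  have hρ := (G.mixDensity_pos hS x).ne'
  simp only [resp_eq, div_pow, mul_pow, gaussianDensity_sq _ (hS _), peakRatioSq, Real.exp_sub,
    Real.exp_neg]
  field_simp

theorem resp_sq_le (hS : ∀ k, (S k).PosDef) (j : Fin K) {k : Fin K} (hk : G.weight k ≠ 0)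
    (x : Ground m) :
    G.resp S j x ^ 2 ≤ G.peakRatioSq S j k *
      Real.exp (mahalanobisSq (G.mean k) (S k) x - mahalanobisSq (G.mean j) (S j) x) := by
  rw [G.resp_sq_eq hS j hk]
  have hq := G.peakRatioSq_nonneg hS j k
  exact mul_le_of_le_one_right (by positivity)
    (pow_le_one₀ (G.resp_nonneg hS k x) (G.resp_le_one hS k x))

theorem resp_le_of_ne (hS : ∀ k, (S k).PosDef) {j k : Fin K} (hjk : j ≠ k) {ε : ℝ} {x : Ground m}
    (h : 1 - ε ≤ G.resp S k x) : G.resp S j x ≤ ε := by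
  have hsum := G.sum_resp hS x
  rw [← Finset.add_sum_erase _ _ (Finset.mem_univ k)] at hsum
  have hj := Finset.single_le_sum (fun i _ => G.resp_nonneg hS i x)
    (Finset.mem_erase.2 ⟨hjk, Finset.mem_univ j⟩)
  linarith

theorem score_mixDensity_add (hS : ∀ k, (S k).PosDef) (k : Fin K) (x : Ground m) :
    score (G.mixDensity S) x + matAct (S k)⁻¹ (x - G.mean k) = ∑ j, G.resp S j x •
      (matAct (S k)⁻¹ (x - G.mean k) - matAct (S j)⁻¹ (x - G.mean j)) := by
  simp only [smul_sub, Finset.sum_sub_distrib, ← Finset.sum_smul]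
  rw [G.score_mixDensity hS, G.sum_resp hS, one_smul, neg_add_eq_sub]

theorem norm_score_mixDensity_add_le (hS : ∀ k, (S k).PosDef) {k : Fin K} {x : Ground m}
    {b c : ℝ} (hb0 : 0 ≤ b) (hc0 : 0 ≤ c)
    (hb : ∀ j ≠ k, G.resp S j x * ‖matAct (S k)⁻¹ (x - G.mean k)‖ ≤ b)
    (hc : ∀ j ≠ k, G.resp S j x * ‖matAct (S j)⁻¹ (x - G.mean j)‖ ≤ c) :
    ‖score (G.mixDensity S) x + matAct (S k)⁻¹ (x - G.mean k)‖ ≤ K * (b + c) := by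
  have hterm (j : Fin K) : ‖G.resp S j x •
      (matAct (S k)⁻¹ (x - G.mean k) - matAct (S j)⁻¹ (x - G.mean j))‖ ≤ b + c := by
    rcases eq_or_ne j k with rfl | hjk
    · simpa using add_nonneg hb0 hc0
    · have hγ := G.resp_nonneg hS j x
      rw [norm_smul, Real.norm_of_nonneg hγ]
      exact (mul_le_mul_of_nonneg_left (norm_sub_le _ _) hγ).trans
        ((mul_add _ _ _).trans_le (add_le_add (hb j hjk) (hc j hjk)))
  rw [G.score_mixDensity_add hS k]
  refine (norm_sum_le_of_le _ fun j _ => hterm j).trans_eq ?_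
  rw [Finset.sum_const, Finset.card_univ, Fintype.card_fin, nsmul_eq_mul]

end GaussianMixture

end Responsibilities

/-! ### The ordinary DAE -/

section OrdinaryDAE

variable {m K : ℕ}

namespace GaussianMixture

variable (G : GaussianMixture m K) {R t : ℝ}

theorem posDef_noisyCov (ht : 0 ≤ t) (k : Fin K) : (G.noisyCov t k).PosDef :=
  posDef_add_smul_one (G.cov_posDef k) ht

theorem smul_one_le_noisyCov (t : ℝ) (k : Fin K) : t • 1 ≤ G.noisyCov t k :=
  le_add_of_nonneg_left (Matrix.nonneg_iff_posSemidef.2 (G.cov_posDef k).posSemidef)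

theorem cov_le_noisyCov (ht : 0 ≤ t) (k : Fin K) : G.cov k ≤ G.noisyCov t k :=
  le_add_of_nonneg_right (Matrix.nonneg_iff_posSemidef.2 (posSemidef_smul_one ht))

theorem noisyCov_le {k : Fin K} (hR : G.cov k ≤ R • 1) (htR : t ≤ R) :
    G.noisyCov t k ≤ (2 * R) • 1 := by
  rw [two_mul, add_smul]
  exact add_le_add hR (smul_le_smul_of_nonneg_right htR zero_le_one)

theorem daeAffine_eq (ht : 0 ≤ t) (k : Fin K) (x : Ground m) :
    G.daeAffine t k x = x - t • matAct (G.noisyCov t k)⁻¹ (x - G.mean k) := by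
  have hN := matAct_matAct_inv (G.posDef_noisyCov ht k).isUnit (x - G.mean k)
  set u := matAct (G.noisyCov t k)⁻¹ (x - G.mean k)
  have hu : matAct (G.cov k) u + t • u = x - G.mean k := by
    rwa [noisyCov, add_matAct, smul_matAct, one_matAct] at hN
  have hv : matAct (1 + t • (G.cov k)⁻¹) (matAct (G.cov k) u) = x - G.mean k := by
    rw [add_matAct, smul_matAct, one_matAct, matAct_inv_matAct (G.cov_posDef k).isUnit, hu]
  rw [daeAffine, ← hv, matAct_inv_matAct (posDef_one_add_smul_inv (G.cov_posDef k) ht).isUnit,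
    eq_sub_of_add_eq hu]
  abel

theorem dae_law (ht : 0 < t) (x : Ground m) :
    dae G.law t x = x + t • score (G.mixDensity (G.noisyCov t)) x := by
  rw [dae, G.heatConv_law ht]

theorem dae_zero (P : Measure (Ground m)) : dae P 0 = id := by
  ext1 x; simp [dae]

theorem daeAffine_zero (k : Fin K) : G.daeAffine 0 k = id := by
  ext1 x; simp [G.daeAffine_eq le_rfl]

theorem measurable_resp (S : Fin K → Matrix (Fin m) (Fin m) ℝ) (k : Fin K) :
    Measurable (G.resp S k) :=
  Measurable.div (by fun_prop) (G.continuous_mixDensity S).measurable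

theorem measurable_dae_law (ht : 0 ≤ t) : Measurable (dae G.law t) := by
  rcases ht.eq_or_lt with rfl | ht
  · rw [dae_zero]; exact measurable_id
  · have := G.measurable_resp (G.noisyCov t)
    simp only [funext (G.dae_law ht), G.score_mixDensity (G.posDef_noisyCov ht.le)]
    fun_prop

theorem mul_norm_matAct_noisyCov_inv_sq_le (ht : 0 ≤ t) (k : Fin K) (x : Ground m) :
    (t * ‖matAct (G.noisyCov t k)⁻¹ (x - G.mean k)‖) ^ 2
      ≤ t * mahalanobisSq (G.mean k) (G.noisyCov t k) x := by
  rw [mul_pow, sq t, mul_assoc, mahalanobisSq_eq_inner]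
  exact mul_le_mul_of_nonneg_left
    (mul_norm_sq_matAct_inv_le (G.posDef_noisyCov ht k) (G.smul_one_le_noisyCov t k) _) ht

/-- The constant in the tail bound for the components of the ordinary DAE that do not belong to the
cluster at hand. The ratio of peak heights contributes `(2R / t) ^ m / w ^ 2`, whose singularity at
`t = 0` is absorbed by `t ^ (m + 2)`; the factorial bounds `D ^ (m + 2) * exp (-D)`. -/
noncomputable def daeTailConst (m : ℕ) (R w r : ℝ) : ℝ :=
  (2 * R) ^ m / w ^ 2 * Real.exp (r ^ 2) * R ^ 2 * (m + 2).factorial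

theorem resp_mul_norm_pow_le {w r ε : ℝ} (ht : 0 < t) (htR : t ≤ R) (hw : 0 < w) (hε0 : 0 ≤ ε)
    (hε1 : ε ≤ 1) {j k : Fin K} (hjk : j ≠ k) {x : Ground m} (hR : G.cov k ≤ R • 1)
    (hk : w ≤ G.weight k) (hx : mahalanobisSq (G.mean k) (G.cov k) x ≤ r ^ 2)
    (hresp : 1 - ε ≤ G.resp (G.noisyCov t) k x) :
    (G.resp (G.noisyCov t) j x * (t * ‖matAct (G.noisyCov t j)⁻¹ (x - G.mean j)‖))
      ^ (2 * (m + 1) + 2) ≤ ε * daeTailConst m R w r := by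
  have hN := G.posDef_noisyCov ht.le
  set γ := G.resp (G.noisyCov t) j x
  set D := mahalanobisSq (G.mean j) (G.noisyCov t j) x
  have hDk : mahalanobisSq (G.mean k) (G.noisyCov t k) x ≤ r ^ 2 :=
    (mahalanobisSq_anti (G.cov_posDef k) (hN k) (G.cov_le_noisyCov ht.le k) _ x).trans hx
  have hq : G.peakRatioSq (G.noisyCov t) j k ≤ (2 * R / t) ^ m / w ^ 2 :=
    G.peakRatioSq_le hN ht hw (G.smul_one_le_noisyCov t j) (G.noisyCov_le hR htR) hk
  have hγ : γ ^ 2 ≤ (2 * R / t) ^ m / w ^ 2 * Real.exp (r ^ 2) * Real.exp (-D) := by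
    refine (G.resp_sq_le hN j (hw.trans_le hk).ne' x).trans ?_
    rw [mul_assoc, ← Real.exp_add, ← sub_eq_add_neg]
    exact mul_le_mul hq (Real.exp_le_exp.2 (by linarith)) (Real.exp_pos _).le
      ((G.peakRatioSq_nonneg hN j k).trans hq)
  have hγε : γ ^ (2 * (m + 1)) ≤ ε := by
    have h0 := G.resp_nonneg hN j x
    have h1 := G.resp_le_of_ne hN hjk hresp
    exact (pow_le_of_le_one h0 (h1.trans hε1) (by omega)).trans h1
  have hR0 : 0 < R := ht.trans_le htR
  refine (mul_pow_le_of_sq_le_mul_exp_neg hε0 (by positivity) ht.le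
    (mahalanobisSq_nonneg (hN j) _ x) hγε hγ
    (G.mul_norm_matAct_noisyCov_inv_sq_le ht.le j x)).trans ?_
  gcongr ε * ?_
  calc (2 * R / t) ^ m / w ^ 2 * Real.exp (r ^ 2) * t ^ (m + 1 + 1) * (m + 1 + 1).factorial
      = (2 * R) ^ m / w ^ 2 * Real.exp (r ^ 2) * t ^ 2 * (m + 2).factorial := by
        rw [div_pow]; field_simp; ring
    _ ≤ daeTailConst m R w r := by unfold daeTailConst; gcongr

theorem norm_dae_sub_daeAffine_le {b c : ℝ} (ht : 0 < t) {k : Fin K} {x : Ground m} (hb0 : 0 ≤ b)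
    (hc0 : 0 ≤ c)
    (hb : ∀ j ≠ k, G.resp (G.noisyCov t) j x *
      (t * ‖matAct (G.noisyCov t k)⁻¹ (x - G.mean k)‖) ≤ b)
    (hc : ∀ j ≠ k, G.resp (G.noisyCov t) j x *
      (t * ‖matAct (G.noisyCov t j)⁻¹ (x - G.mean j)‖) ≤ c) :
    ‖dae G.law t x - G.daeAffine t k x‖ ≤ K * (b + c) := by
  have heq : dae G.law t x - G.daeAffine t k x = t • (score (G.mixDensity (G.noisyCov t)) x +
      matAct (G.noisyCov t k)⁻¹ (x - G.mean k)) := by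
    rw [G.dae_law ht, G.daeAffine_eq ht.le]; module
  have hdiv {γ a d : ℝ} (h : γ * (t * a) ≤ d) : γ * a ≤ d / t :=
    (le_div_iff₀ ht).2 (by linarith)
  rw [heq, norm_smul, Real.norm_of_nonneg ht.le]
  refine (mul_le_mul_of_nonneg_left (G.norm_score_mixDensity_add_le (G.posDef_noisyCov ht.le)
    (div_nonneg hb0 ht.le) (div_nonneg hc0 ht.le) (fun j hj => hdiv (hb j hj))
    fun j hj => hdiv (hc j hj)) ht.le).trans_eq ?_
  field_simp

theorem exists_norm_dae_sub_daeAffine_le (m K : ℕ) {R w δ : ℝ} (r : ℝ) (hR : 0 < R) (hw : 0 < w)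
    (hδ : 0 < δ) :
    ∃ ε : ℝ, 0 < ε ∧ ∀ (G : GaussianMixture m K) (t : ℝ), 0 ≤ t → t ≤ R →
      ∀ k x, G.cov k ≤ R • 1 → w ≤ G.weight k → mahalanobisSq (G.mean k) (G.cov k) x ≤ r ^ 2 →
        1 - ε ≤ G.resp (G.noisyCov t) k x → ‖dae G.law t x - G.daeAffine t k x‖ ≤ δ := by
  set b : ℝ := δ / (2 * (K + 1)) with hb
  have hb0 : 0 < b := by positivity
  obtain ⟨ε, ⟨⟨hε1, hεk⟩, hεj⟩, hε : 0 < ε⟩ :=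
    (((eventually_mul_le 1 one_pos).and (eventually_mul_le (√(R * r ^ 2)) hb0)).and
      (eventually_mul_le (daeTailConst m R w r) (pow_pos hb0 (2 * (m + 1) + 2)))).and
      self_mem_nhdsWithin |>.exists
  refine ⟨ε, hε, fun G t ht htR k x hcov hk hx hresp => ?_⟩
  rcases ht.eq_or_lt with rfl | ht
  · simp [dae_zero, G.daeAffine_zero, hδ.le]
  have hN := G.posDef_noisyCov ht.le
  have hcenter : t * ‖matAct (G.noisyCov t k)⁻¹ (x - G.mean k)‖ ≤ √(R * r ^ 2) := by
    refine Real.le_sqrt_of_sq_le ((G.mul_norm_matAct_noisyCov_inv_sq_le ht.le k x).trans ?_)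
    exact mul_le_mul htR ((mahalanobisSq_anti (G.cov_posDef k) (hN k)
      (G.cov_le_noisyCov ht.le k) _ x).trans hx) (mahalanobisSq_nonneg (hN k) _ x) hR.le
  calc ‖dae G.law t x - G.daeAffine t k x‖ ≤ K * (b + b) := by
        refine G.norm_dae_sub_daeAffine_le ht hb0.le hb0.le (fun j hj => ?_) fun j hj => ?_
        · exact (mul_le_mul (G.resp_le_of_ne hN hj hresp) hcenter (by positivity) hε.le).trans hεk
        · exact le_of_pow_le_pow_left₀ (by omega) hb0.le ((G.resp_mul_norm_pow_le ht htR hw hε.le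
            (by simpa using hε1) hj hcov hk hx hresp).trans hεj)
    _ = δ * (K / (K + 1)) := by rw [hb]; field_simp; ring
    _ ≤ δ := mul_le_of_le_one_right hδ.le ((div_le_one (by positivity)).2 (by linarith))

theorem map_daeAffine (ht : 0 ≤ t) (k : Fin K) :
    (multivariateGaussian (G.mean k) (G.cov k)).map (G.daeAffine t k)
      = multivariateGaussian (G.mean k) (G.daeCov t k) := by
  have hS := G.cov_posDef k
  have hA : ((1 + t • (G.cov k)⁻¹)⁻¹)ᴴ = (1 + t • (G.cov k)⁻¹)⁻¹ :=
    (posDef_one_add_smul_inv hS ht).inv.1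
  have hcomm : Commute (1 + t • (G.cov k)⁻¹)⁻¹ (G.cov k) := by
    have h : Commute (G.cov k)⁻¹ (G.cov k) := by
      simpa only [Matrix.zpow_neg_one] using Matrix.Commute.zpow_self (G.cov k) (-1)
    simpa only [Matrix.zpow_neg_one] using
      Matrix.Commute.zpow_left ((Commute.one_left _).add_left (h.smul_left t)) (-1)
  have haffine : G.daeAffine t k = fun x => matAct (1 + t • (G.cov k)⁻¹)⁻¹ x +
      (G.mean k - matAct (1 + t • (G.cov k)⁻¹)⁻¹ (G.mean k)) := by
    ext1 x
    rw [daeAffine, matAct_sub]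
    abel
  rw [haffine, map_multivariateGaussian_matAct_add _ _ hS.posSemidef, daeCov,
    add_sub_cancel, hcomm.eq, mul_assoc, sq, ← Matrix.conjTranspose_eq_transpose_of_trivial, hA]

end GaussianMixture

end OrdinaryDAE

section LevyProkhorov

theorem sum_smul_map_le_thickening {ι Ω E : Type*} [Fintype ι] [MeasurableSpace Ω]
    [PseudoMetricSpace E] [MeasurableSpace E] [OpensMeasurableSpace E] (P : ι → Measure Ω)
    (c : ι → ℝ≥0∞) {u v : ι → Ω → E} (hu : ∀ i, Measurable (u i)) (hv : ∀ i, Measurable (v i))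
    (r : ℝ) {B : Set E} (hB : MeasurableSet B) :
    (∑ i, c i • (P i).map (u i)) B ≤ (∑ i, c i • (P i).map (v i)) (Metric.thickening r B) +
      ∑ i, c i * P i {x | r ≤ dist (u i x) (v i x)} := by
  simp only [Measure.finsetSum_apply, Measure.smul_apply, smul_eq_mul,
    Measure.map_apply (hu _) hB, Measure.map_apply (hv _) Metric.isOpen_thickening.measurableSet]
  rw [← Finset.sum_add_distrib]
  refine Finset.sum_le_sum fun i _ => ?_
  have hsub : u i ⁻¹' B ⊆ v i ⁻¹' Metric.thickening r B ∪ {x | r ≤ dist (u i x) (v i x)} := by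
    intro x hx
    rcases lt_or_ge (dist (u i x) (v i x)) r with h | h
    · exact .inl (Metric.mem_thickening_iff.2 ⟨u i x, hx, by rwa [dist_comm]⟩)
    · exact .inr h
  rw [← mul_add]
  gcongr
  exact (measure_mono hsub).trans (measure_union_le _ _)

theorem levyProkhorovEDist_sum_smul_map_le {ι Ω E : Type*} [Fintype ι] [MeasurableSpace Ω]
    [PseudoMetricSpace E] [MeasurableSpace E] [OpensMeasurableSpace E] (P : ι → Measure Ω)
    (c : ι → ℝ≥0∞) {u v : ι → Ω → E} (hu : ∀ i, Measurable (u i)) (hv : ∀ i, Measurable (v i))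
    {δ : ℝ≥0∞} (h : ∑ i, c i * P i {x | δ.toReal ≤ dist (u i x) (v i x)} ≤ δ) :
    levyProkhorovEDist (∑ i, c i • (P i).map (u i)) (∑ i, c i • (P i).map (v i)) ≤ δ := by
  refine sInf_le fun B hB => ⟨?_, ?_⟩
  · exact (sum_smul_map_le_thickening P c hu hv _ hB).trans (by gcongr)
  · simp only [dist_comm (u _ _)] at h
    exact (sum_smul_map_le_thickening P c hv hu _ hB).trans (by gcongr)

theorem measure_le_add_of_inter_subset {Ω : Type*} [MeasurableSpace Ω] {P : Measure Ω}
    [IsProbabilityMeasure P] {A Q C : Set Ω} (hA : MeasurableSet A) (hQ : MeasurableSet Q)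
    {ε : ℝ≥0∞} (hC : 1 - ε ≤ P C) (h : A ∩ C ⊆ Q) : P A ≤ P Q + ε := by
  have hdisj : C ⊆ (A \ Q)ᶜ := fun x hxC hx => hx.2 (h ⟨hx.1, hxC⟩)
  have hdiff : P C + P (A \ Q) ≤ P C + ε :=
    calc P C + P (A \ Q) ≤ P (A \ Q)ᶜ + P (A \ Q) := by gcongr
      _ = 1 := by rw [add_comm, prob_add_prob_compl (hA.diff hQ)]
      _ ≤ P C + ε := tsub_le_iff_right.1 hC
  calc P A ≤ P (Q ∪ A \ Q) := measure_mono (by rw [union_sdiff_self]; exact subset_union_right)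
    _ ≤ P Q + P (A \ Q) := measure_union_le _ _
    _ ≤ P Q + ε := by gcongr; exact (ENNReal.add_le_add_iff_left (measure_ne_top P C)).1 hdiff

namespace GaussianMixture

variable {m K : ℕ}

theorem WellSeparated.mono {G : GaussianMixture m K} {S : Fin K → Matrix (Fin m) (Fin m) ℝ}
    {Ω : Fin K → Set (Ground m)} {ε ε' : ℝ} (h : G.WellSeparated S Ω ε) (hε : ε ≤ ε') :
    G.WellSeparated S Ω ε' := fun k =>
  ⟨(h k).1, (ENNReal.ofReal_le_ofReal (by linarith)).trans (h k).2.1,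
    fun x hx => (by linarith : 1 - ε' ≤ 1 - ε).trans ((h k).2.2 x hx)⟩

theorem exists_measure_le_dist_dae_daeAffine_le (m K : ℕ) {R w δ η : ℝ} (hR : 0 < R) (hw : 0 < w)
    (hδ : 0 < δ) (hη : 0 < η) :
    ∃ ε : ℝ, 0 < ε ∧ ∀ (G : GaussianMixture m K) (t : ℝ) (Ω : Fin K → Set (Ground m)),
      0 ≤ t → t ≤ R → G.WellSeparated (G.noisyCov t) Ω ε →
      ∀ k, G.cov k ≤ R • 1 → w ≤ G.weight k →
        multivariateGaussian (G.mean k) (G.cov k)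
          {x | δ ≤ dist (dae G.law t x) (G.daeAffine t k x)} ≤ ENNReal.ofReal η := by
  obtain ⟨r, hr, htail⟩ := exists_measure_norm_gt_le (stdGaussian (Ground m))
    (ENNReal.ofReal_pos.2 (half_pos hη))
  obtain ⟨ε, hε, hclose⟩ := exists_norm_dae_sub_daeAffine_le m K r hR hw (half_pos hδ)
  refine ⟨min ε (η / 2), by positivity, fun G t Ω ht htR hsep k hcov hk => ?_⟩
  have hdae := G.measurable_dae_law ht
  have haffine : Measurable (G.daeAffine t k) := by unfold daeAffine; fun_prop
  have hC : 1 - ENNReal.ofReal (η / 2) ≤ multivariateGaussian (G.mean k) (G.cov k) (Ω k) := by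
    rw [← ENNReal.ofReal_one, ← ENNReal.ofReal_sub _ (half_pos hη).le]
    exact (hsep.mono (min_le_right ..) k).2.1
  refine (measure_le_add_of_inter_subset
    (Q := {x | r ^ 2 < mahalanobisSq (G.mean k) (G.cov k) x})
    (measurableSet_le measurable_const (hdae.dist haffine))
    (measurableSet_lt (by fun_prop) (by fun_prop)) hC ?_).trans ?_
  · rintro x ⟨hbad, hx⟩
    by_contra hxr
    have hgood := hclose G t ht htR k x hcov hk (not_lt.1 hxr)
      ((hsep.mono (min_le_left ..) k).2.2 x hx)
    rw [mem_ofPred_eq, dist_eq_norm] at hbad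
    linarith
  · rw [multivariateGaussian_mahalanobisSq_gt _ (G.cov_posDef k) hr.le]
    calc _ ≤ ENNReal.ofReal (η / 2) + ENNReal.ofReal (η / 2) := by gcongr
      _ = ENNReal.ofReal η := by
        rw [← ENNReal.ofReal_add (half_pos hη).le (half_pos hη).le, add_halves]

theorem map_law (G : GaussianMixture m K) {f : Ground m → Ground m} (hf : Measurable f) :
    G.law.map f = ∑ k, ENNReal.ofReal (G.weight k) •
      (multivariateGaussian (G.mean k) (G.cov k)).map f := by
  simp only [law, gaussianSum, ← Measure.mapₗ_apply_of_measurable hf, map_sum, map_smul]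

theorem exists_levyProkhorovEDist_dae_le (m K : ℕ) {R δ : ℝ} (hR : 0 < R) (hδ : 0 < δ) :
    ∃ ε : ℝ, 0 < ε ∧ ∀ (G : GaussianMixture m K) (t : ℝ) (Ω : Fin K → Set (Ground m)),
      (∀ k, G.cov k ≤ R • 1) → 0 ≤ t → t ≤ R → G.WellSeparated (G.noisyCov t) Ω ε →
      levyProkhorovEDist (G.law.map (dae G.law t))
        (gaussianSum G.weight G.mean (G.daeCov t)) ≤ ENNReal.ofReal δ := by
  set w : ℝ := δ / (2 * (K + 1)) with hw
  have hw0 : 0 < w := by positivity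
  obtain ⟨ε, hε, hbad⟩ := exists_measure_le_dist_dae_daeAffine_le m K hR hw0 hδ (half_pos hδ)
  refine ⟨ε, hε, fun G t Ω hcov ht htR hsep => ?_⟩
  have haffine (k : Fin K) : Measurable (G.daeAffine t k) := by unfold daeAffine; fun_prop
  simp only [G.map_law (G.measurable_dae_law ht), gaussianSum, ← G.map_daeAffine ht]
  refine levyProkhorovEDist_sum_smul_map_le _ _ (fun _ => G.measurable_dae_law ht) haffine ?_
  rw [ENNReal.toReal_ofReal hδ.le]
  have hterm (k : Fin K) : ENNReal.ofReal (G.weight k) *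
      multivariateGaussian (G.mean k) (G.cov k)
        {x | δ ≤ dist (dae G.law t x) (G.daeAffine t k x)} ≤
      ENNReal.ofReal (G.weight k * (δ / 2) + w) := by
    have hk := G.weight_nonneg k
    rcases lt_or_ge (G.weight k) w with hlt | hge
    · refine (mul_le_of_le_one_right (zero_le) prob_le_one).trans (ENNReal.ofReal_le_ofReal ?_)
      have : 0 ≤ G.weight k * (δ / 2) := by positivity
      linarith
    · refine (mul_le_mul_right (hbad G t Ω ht htR hsep k (hcov k) hge) _).trans ?_
      rw [← ENNReal.ofReal_mul hk]
      exact ENNReal.ofReal_le_ofReal (by linarith)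
  refine (Finset.sum_le_sum fun k _ => hterm k).trans ?_
  rw [← ENNReal.ofReal_sum_of_nonneg fun k _ => by have := G.weight_nonneg k; positivity]
  refine ENNReal.ofReal_le_ofReal ?_
  calc ∑ k, (G.weight k * (δ / 2) + w) = δ / 2 + K * w := by
        simp [Finset.sum_add_distrib, ← Finset.sum_mul, G.weight_sum]
    _ = δ / 2 + δ / 2 * (K / (K + 1)) := by rw [hw]; field_simp
    _ ≤ δ / 2 + δ / 2 := by
      gcongr
      exact mul_le_of_le_one_right (half_pos hδ).le ((div_le_one (by positivity)).2 (by linarith))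
    _ = δ := add_halves δ

end GaussianMixture

end LevyProkhorov

/-! ### The backward heat equation -/

section Laplacian

open scoped ContDiff Laplacian

variable {E F ι : Type*} [NormedAddCommGroup E] [InnerProductSpace ℝ E] [FiniteDimensional ℝ E]
  [NormedAddCommGroup F] [NormedSpace ℝ F] [Fintype ι]

theorem laplacian_eq_sum_fderiv_fderiv_apply (b : OrthonormalBasis ι ℝ E) {f : E → F}
    (hf : ContDiff ℝ 2 f) (x : E) :
    Δ f x = ∑ i, fderiv ℝ (fun y => fderiv ℝ f y (b i)) x (b i) := by
  have hf' : DifferentiableAt ℝ (fderiv ℝ f) x :=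
    (hf.fderiv_right (m := 1) (by norm_num)).differentiable one_ne_zero x
  rw [InnerProductSpace.laplacian_eq_iteratedFDeriv_orthonormalBasis f b]
  refine Finset.sum_congr rfl fun i _ => ?_
  simp [iteratedFDeriv_two_apply, fderiv_clm_apply hf' (differentiableAt_const _)]

theorem continuous_laplacian {f : E → F} (hf : ContDiff ℝ 2 f) : Continuous (Δ f) := by
  rw [InnerProductSpace.laplacian_eq_iteratedFDeriv_stdOrthonormalBasis]
  have := hf.continuous_iteratedFDeriv le_rfl
  fun_prop

theorem hasCompactSupport_laplacian {f : E → F} (hf : HasCompactSupport f) :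
    HasCompactSupport (Δ f) := by
  rw [InnerProductSpace.laplacian_eq_iteratedFDeriv_stdOrthonormalBasis]
  exact (hf.iteratedFDeriv (𝕜 := ℝ) 2).comp_left (g := fun L : E [×2]→L[ℝ] F =>
    ∑ i, L ![stdOrthonormalBasis ℝ E i, stdOrthonormalBasis ℝ E i]) (by simp)

theorem laplacian_comp_smul {f : E → F} (hf : ContDiff ℝ 2 f) (c : ℝ) (x : E) :
    Δ (fun y => f (c • y)) x = c ^ 2 • Δ f (c • x) := by
  have h := congrFun (iteratedFDeriv_comp_const_smul (i := 2) c hf) x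
  simp only [InnerProductSpace.laplacian_eq_iteratedFDeriv_stdOrthonormalBasis]
  rw [h, Finset.smul_sum]
  rfl

theorem laplacian_fun_smul (b : OrthonormalBasis ι ℝ E) {g : E → ℝ} {f : E → F}
    (hg : ContDiff ℝ 2 g) (hf : ContDiff ℝ 2 f) (x : E) :
    Δ (fun y => g y • f y) x =
      g x • Δ f x + (2 : ℝ) • ∑ i, fderiv ℝ g x (b i) • fderiv ℝ f x (b i) + Δ g x • f x := by
  have hgd : Differentiable ℝ g := hg.differentiable two_ne_zero
  have hfd : Differentiable ℝ f := hf.differentiable two_ne_zero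
  have hgd' (v : E) : Differentiable ℝ fun y => fderiv ℝ g y v :=
    ((hg.fderiv_right (m := 1) (by norm_num)).differentiable one_ne_zero).clm_apply
      (differentiable_const v)
  have hfd' (v : E) : Differentiable ℝ fun y => fderiv ℝ f y v :=
    ((hf.fderiv_right (m := 1) (by norm_num)).differentiable one_ne_zero).clm_apply
      (differentiable_const v)
  have h1 (v : E) : (fun y => fderiv ℝ (fun z => g z • f z) y v)
      = fun y => g y • fderiv ℝ f y v + fderiv ℝ g y v • f y := by
    ext y
    simp [fderiv_fun_smul (hgd y) (hfd y)]
  rw [laplacian_eq_sum_fderiv_fderiv_apply b (f := fun y => g y • f y) (hg.smul hf),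
    laplacian_eq_sum_fderiv_fderiv_apply b hg, laplacian_eq_sum_fderiv_fderiv_apply b hf,
    Finset.smul_sum, Finset.smul_sum, Finset.sum_smul, ← Finset.sum_add_distrib,
    ← Finset.sum_add_distrib]
  refine Finset.sum_congr rfl fun i _ => ?_
  rw [h1, fderiv_fun_add ((hgd x).fun_smul (hfd' _ x)) ((hgd' _ x).fun_smul (hfd x)),
    fderiv_fun_smul (hgd x) (hfd' _ x), fderiv_fun_smul (hgd' _ x) (hfd x)]
  simp only [add_apply, smul_apply, ContinuousLinearMap.smulRight_apply]
  module

end Laplacian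

section PlaneWave

open BoundedContinuousFunction (innerProbChar innerProbChar_apply)
open scoped ContDiff Laplacian

variable {E : Type*} [NormedAddCommGroup E] [InnerProductSpace ℝ E]

theorem norm_innerProbChar (ξ x : E) : ‖innerProbChar ξ x‖ = 1 := by
  rw [innerProbChar_apply, Complex.norm_exp_ofReal_mul_I]

theorem contDiff_innerProbChar (ξ : E) {n : ℕ∞ω} : ContDiff ℝ n (innerProbChar ξ) := by
  have h : ContDiff ℝ n fun x : E => ((inner ℝ x ξ : ℝ) : ℂ) :=
    Complex.ofRealCLM.contDiff.comp (contDiff_id.inner ℝ contDiff_const)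
  exact (h.mul contDiff_const).cexp

theorem fderiv_innerProbChar_apply (ξ x v : E) :
    fderiv ℝ (innerProbChar ξ) x v = inner ℝ v ξ * Complex.I * innerProbChar ξ x := by
  have h : HasFDerivAt (fun y : E => (inner ℝ y ξ : ℂ) * Complex.I)
      ((Complex.ofRealCLM.comp (innerSL ℝ ξ)).smulRight Complex.I) x := by
    convert! ((Complex.ofRealCLM.comp (innerSL ℝ ξ)).smulRight Complex.I).hasFDerivAt using 1
    ext y
    simp [real_inner_comm]
  have h' : HasFDerivAt (innerProbChar ξ) _ x := h.cexp
  rw [h'.fderiv]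
  simp [innerProbChar_apply, real_inner_comm, mul_comm]

variable [FiniteDimensional ℝ E]

theorem laplacian_innerProbChar (ξ x : E) :
    Δ (innerProbChar ξ : E → ℂ) x = -‖ξ‖ ^ 2 * innerProbChar ξ x := by
  have hd : Differentiable ℝ (innerProbChar ξ) :=
    (contDiff_innerProbChar ξ (n := 1)).differentiable one_ne_zero
  have hξ : (‖ξ‖ : ℂ) ^ 2 = ∑ i, (inner ℝ (stdOrthonormalBasis ℝ E i) ξ : ℂ) ^ 2 :=
    mod_cast ((stdOrthonormalBasis ℝ E).sum_sq_inner_right ξ).symm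
  rw [laplacian_eq_sum_fderiv_fderiv_apply (stdOrthonormalBasis ℝ E) (contDiff_innerProbChar ξ),
    hξ, ← Finset.sum_neg_distrib, Finset.sum_mul]
  refine Finset.sum_congr rfl fun i _ => ?_
  simp only [fderiv_innerProbChar_apply]
  rw [fderiv_const_mul (hd x), smul_apply, fderiv_innerProbChar_apply, smul_eq_mul]
  linear_combination (inner ℝ (stdOrthonormalBasis ℝ E i) ξ : ℂ) ^ 2 * innerProbChar ξ x *
    Complex.I_sq

theorem laplacian_smul_innerProbChar_add (ξ : E) {g : E → ℝ} (hg : ContDiff ℝ 2 g) (x : E) :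
    Δ (fun y => g y • innerProbChar ξ y) x + ‖ξ‖ ^ 2 * (g x • innerProbChar ξ x) =
      (Δ g x + 2 * fderiv ℝ g x ξ * Complex.I) * innerProbChar ξ x := by
  set b := stdOrthonormalBasis ℝ E
  have hDξ : ∑ i, fderiv ℝ g x (b i) * inner ℝ (b i) ξ = fderiv ℝ g x ξ := by
    conv_rhs => rw [← b.sum_repr' ξ, map_sum]
    exact Finset.sum_congr rfl fun i _ => by rw [map_smul, smul_eq_mul, mul_comm]
  have hcross : ∑ i, fderiv ℝ g x (b i) • fderiv ℝ (innerProbChar ξ) x (b i) =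
      fderiv ℝ g x ξ * (Complex.I * innerProbChar ξ x) := by
    rw [← hDξ, Complex.ofReal_sum, Finset.sum_mul]
    refine Finset.sum_congr rfl fun i _ => ?_
    rw [fderiv_innerProbChar_apply, Complex.real_smul]
    push_cast
    ring
  rw [laplacian_fun_smul b hg (contDiff_innerProbChar ξ), laplacian_innerProbChar, hcross]
  simp only [Complex.real_smul, Complex.ofReal_ofNat]
  ring

/-- The plane wave of frequency `ξ`, cut off smoothly at distance `2 / ε` from the origin: a test
function that is nearly an eigenfunction of the Laplacian, with eigenvalue `-‖ξ‖ ^ 2`. -/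
noncomputable def cutoffWave (ξ : E) (ε : ℝ) (x : E) : ℂ :=
  (⟨1, 2, one_pos, one_lt_two⟩ : ContDiffBump (0 : E)) (ε • x) • innerProbChar ξ x

theorem contDiff_cutoffWave (ξ : E) (ε : ℝ) {n : ℕ∞} : ContDiff ℝ n (cutoffWave ξ ε) :=
  ((ContDiffBump.contDiff _).comp (contDiff_const_smul ε)).smul (contDiff_innerProbChar ξ)

theorem hasCompactSupport_cutoffWave (ξ : E) {ε : ℝ} (hε : ε ≠ 0) :
    HasCompactSupport (cutoffWave ξ ε) :=
  ((ContDiffBump.hasCompactSupport _).comp_smul hε).smul_right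

theorem norm_cutoffWave_le_one (ξ : E) (ε : ℝ) (x : E) : ‖cutoffWave ξ ε x‖ ≤ 1 := by
  rw [cutoffWave, norm_smul, norm_innerProbChar, mul_one,
    Real.norm_of_nonneg (ContDiffBump.nonneg _)]
  exact ContDiffBump.le_one _

theorem tendsto_cutoffWave (ξ x : E) :
    Filter.Tendsto (fun ε => cutoffWave ξ ε x) (𝓝 0) (𝓝 (innerProbChar ξ x)) := by
  set χ : ContDiffBump (0 : E) := ⟨1, 2, one_pos, one_lt_two⟩
  have hχ : Continuous fun ε : ℝ => χ (ε • x) • innerProbChar ξ x := by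
    have := χ.continuous
    fun_prop
  have h0 : χ ((0 : ℝ) • x) = 1 := by simp [χ.one_of_mem_closedBall, χ.rIn_pos.le]
  have h := hχ.tendsto 0
  rwa [h0, one_smul] at h

theorem exists_norm_laplacian_cutoffWave_add_le (ξ : E) : ∃ C, ∀ ε ∈ Ioc (0 : ℝ) 1, ∀ x,
    ‖Δ (cutoffWave ξ ε) x + ‖ξ‖ ^ 2 * cutoffWave ξ ε x‖ ≤ ε * C := by
  set χ : ContDiffBump (0 : E) := ⟨1, 2, one_pos, one_lt_two⟩
  have hχ : ContDiff ℝ 2 χ := χ.contDiff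
  obtain ⟨A, hA⟩ := (hasCompactSupport_laplacian χ.hasCompactSupport).exists_bound_of_continuous
    (continuous_laplacian hχ)
  obtain ⟨B, hB⟩ := (χ.hasCompactSupport.fderiv_apply (𝕜 := ℝ) ξ).exists_bound_of_continuous
    ((hχ.continuous_fderiv two_ne_zero).clm_apply continuous_const)
  refine ⟨A + 2 * B, fun ε ⟨hε0, hε1⟩ x => ?_⟩
  have : 0 ≤ A := (norm_nonneg _).trans (hA 0)
  have hB' : ‖fderiv ℝ (fun y => χ (ε • y)) x ξ‖ ≤ ε * B := by
    rw [fderiv_comp_smul, smul_apply, norm_smul, Real.norm_of_nonneg hε0.le]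
    gcongr
    exact hB _
  have hA' : ‖Δ (fun y => χ (ε • y)) x‖ ≤ ε * A := by
    rw [laplacian_comp_smul hχ, norm_smul, Real.norm_of_nonneg (sq_nonneg ε)]
    gcongr
    · exact pow_le_of_le_one hε0.le hε1 two_ne_zero
    · exact hA _
  change ‖Δ (fun y => χ (ε • y) • innerProbChar ξ y) x + _ * (χ (ε • x) • innerProbChar ξ x)‖ ≤ _
  rw [laplacian_smul_innerProbChar_add ξ (g := fun y => χ (ε • y))
    (hχ.comp (contDiff_const_smul ε)), norm_mul, norm_innerProbChar, mul_one]
  refine (norm_add_le _ _).trans ?_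
  rw [norm_mul, norm_mul, Complex.norm_I, mul_one, Complex.norm_real, Complex.norm_real,
    Complex.norm_ofNat, mul_add, mul_left_comm]
  gcongr

end PlaneWave

section Bound

variable {E F : Type*} [NormedAddCommGroup E] [NormedSpace ℝ E] [NormedAddCommGroup F]
  [NormedSpace ℝ F] {f : E → F}

theorem exists_norm_fderiv_apply_le {V : ℝ → E → E} {J : Set ℝ} (hJ : IsCompact J)
    (hV : ContinuousOn V.uncurry (J ×ˢ univ)) (hf : ContDiff ℝ 1 f) (hsupp : HasCompactSupport f) :
    ∃ C, ∀ s ∈ J, ∀ y, ‖fderiv ℝ f y (V s y)‖ ≤ C := by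
  have hcont : ContinuousOn (fun z : ℝ × E => fderiv ℝ f z.2 (V z.1 z.2)) (J ×ˢ univ) :=
    ((hf.continuous_fderiv one_ne_zero).comp continuous_snd).continuousOn.clm_apply hV
  obtain ⟨C, hC⟩ := (hJ.prod hsupp).exists_bound_of_continuousOn
    (hcont.mono (prod_mono_right (subset_univ _)))
  refine ⟨max C 0, fun s hs y => ?_⟩
  by_cases hy : y ∈ tsupport f
  · exact (hC (s, y) ⟨hs, hy⟩).trans (le_max_left _ _)
  · rw [fderiv_of_notMem_tsupport ℝ hy]
    simp

end Bound

section Transport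

open scoped ContDiff Laplacian Gradient

variable {E F Ω : Type*} [NormedAddCommGroup E] [InnerProductSpace ℝ E] [FiniteDimensional ℝ E]
  [MeasurableSpace E] [BorelSpace E] [NormedAddCommGroup F] [NormedSpace ℝ F] {f : E → F}

theorem integral_fderiv_gradient_eq_neg_integral_smul_laplacian (μ : Measure E)
    [μ.IsAddHaarMeasure] {ρ : E → ℝ} (hd : Differentiable ℝ ρ) (hc : Continuous (∇ ρ))
    (hf : ContDiff ℝ 2 f) (hsupp : HasCompactSupport f) :
    ∫ x, fderiv ℝ f x (∇ ρ x) ∂μ = -∫ x, ρ x • Δ f x ∂μ := by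
  set b := stdOrthonormalBasis ℝ E
  have hDρ (x v) : fderiv ℝ ρ x v = inner ℝ (∇ ρ x) v := by
    rw [gradient, InnerProductSpace.toDual_symm_apply]
  have hρ' (v) : Continuous fun x => fderiv ℝ ρ x v := by
    simp_rw [hDρ]
    fun_prop
  have hf1 (v) : ContDiff ℝ 1 fun y => fderiv ℝ f y v :=
    (hf.fderiv_right (by norm_num)).clm_apply contDiff_const
  have hs1 (v) : HasCompactSupport fun y => fderiv ℝ f y v := hsupp.fderiv_apply ℝ v
  have hf2 (v) : Continuous fun x => fderiv ℝ (fun y => fderiv ℝ f y v) x v :=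
    ((hf1 v).continuous_fderiv one_ne_zero).clm_apply continuous_const
  have hint1 (v) : Integrable (fun x => fderiv ℝ ρ x v • fderiv ℝ f x v) μ :=
    ((hρ' v).smul (hf1 v).continuous).integrable_of_hasCompactSupport (hs1 v).smul_left
  have hint2 (v) : Integrable (fun x => ρ x • fderiv ℝ (fun y => fderiv ℝ f y v) x v) μ :=
    (hd.continuous.smul (hf2 v)).integrable_of_hasCompactSupport
      ((hs1 v).fderiv_apply ℝ v).smul_left
  have hint3 (v) : Integrable (fun x => ρ x • fderiv ℝ f x v) μ :=
    (hd.continuous.smul (hf1 v).continuous).integrable_of_hasCompactSupport (hs1 v).smul_left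
  have hsum (x) : fderiv ℝ f x (∇ ρ x) = ∑ i, fderiv ℝ ρ x (b i) • fderiv ℝ f x (b i) := by
    conv_lhs => rw [← b.sum_repr' (∇ ρ x), map_sum]
    exact Finset.sum_congr rfl fun i _ => by rw [map_smul, hDρ, real_inner_comm]
  simp_rw [hsum, laplacian_eq_sum_fderiv_fderiv_apply b hf, Finset.smul_sum]
  rw [integral_finsetSum _ fun i _ => hint1 (b i), integral_finsetSum _ fun i _ => hint2 (b i),
    ← Finset.sum_neg_distrib]
  refine Finset.sum_congr rfl fun i _ => ?_
  rw [integral_smul_fderiv_eq_neg_fderiv_smul_of_integrable (hint1 _) (hint2 _) (hint3 _)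
    (fun x _ => hd x) (fun x _ => (hf1 _).differentiable one_ne_zero x), neg_neg]

theorem smul_score {m : ℕ} {ρ : Ground m → ℝ} {x : Ground m} (hpos : 0 < ρ x)
    (hd : DifferentiableAt ℝ ρ x) : ρ x • score ρ x = ∇ ρ x := by
  have h := (hd.hasFDerivAt.log hpos.ne').hasGradientAt.gradient
  rw [score, h, gradient, map_smul, smul_smul, mul_inv_cancel₀ hpos.ne', one_smul]

theorem integral_fderiv_score_withDensity {m : ℕ} {ρ : Ground m → ℝ} (hpos : ∀ x, 0 < ρ x)
    (hd : Differentiable ℝ ρ) (hc : Continuous (score ρ)) {f : Ground m → F}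
    (hf : ContDiff ℝ 2 f) (hsupp : HasCompactSupport f) :
    ∫ x, fderiv ℝ f x (score ρ x) ∂(volume.withDensity fun x => ENNReal.ofReal (ρ x)) =
      -∫ x, Δ f x ∂(volume.withDensity fun x => ENNReal.ofReal (ρ x)) := by
  have hρ : ∇ ρ = fun x => ρ x • score ρ x := funext fun x => (smul_score (hpos x) (hd x)).symm
  have hc' : Continuous (∇ ρ) := hρ ▸ hd.continuous.smul hc
  rw [integral_withDensity_eq_integral_toReal_smul hd.continuous.measurable.ennreal_ofReal
      (by simp), integral_withDensity_eq_integral_toReal_smul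
      hd.continuous.measurable.ennreal_ofReal (by simp)]
  simp only [ENNReal.toReal_ofReal (hpos _).le]
  rw [← integral_fderiv_gradient_eq_neg_integral_smul_laplacian volume hd hc' hf hsupp, hρ]
  simp only [map_smul]

variable [MeasurableSpace Ω] {P : Measure Ω} [IsFiniteMeasure P] {φ : ℝ → Ω → E}

theorem hasDerivAt_integral_comp_flow {V : ℝ → E → E} {U : Set ℝ} {t : ℝ} (hU : U ∈ 𝓝 t)
    (hφ : ∀ s ∈ U, Measurable (φ s)) (hV : ContinuousOn V.uncurry (U ×ˢ univ))
    (hode : ∀ a, ∀ s ∈ U, HasDerivAt (fun r => φ r a) (V s (φ s a)) s)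
    (hf : ContDiff ℝ 1 f) (hsupp : HasCompactSupport f) :
    HasDerivAt (fun s => ∫ a, f (φ s a) ∂P) (∫ a, fderiv ℝ f (φ t a) (V t (φ t a)) ∂P) t := by
  obtain ⟨J, hJ, hJU, hJc⟩ := local_compact_nhds hU
  obtain ⟨C, hC⟩ := exists_norm_fderiv_apply_le hJc (hV.mono (prod_mono_left hJU)) hf hsupp
  obtain ⟨Cf, hCf⟩ := hsupp.exists_bound_of_continuous hf.continuous
  have htU := mem_of_mem_nhds hU
  have hVt : Continuous (V t) := continuousOn_univ.1 <|
    hV.comp (f := fun y => (t, y)) (by fun_prop) fun y _ => ⟨htU, mem_univ y⟩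
  have hf't : Continuous fun y => fderiv ℝ f y (V t y) :=
    (hf.continuous_fderiv one_ne_zero).clm_apply hVt
  have hmeas (s) (hs : s ∈ U) : AEStronglyMeasurable (fun a => f (φ s a)) P :=
    (hf.continuous.stronglyMeasurable.comp_measurable (hφ s hs)).aestronglyMeasurable
  refine (hasDerivAt_integral_of_dominated_loc_of_deriv_le
    (F' := fun s a => fderiv ℝ f (φ s a) (V s (φ s a))) (bound := fun _ => C) hJ
    (Filter.mem_of_superset hU hmeas) (.of_bound (hmeas t htU) Cf (.of_forall fun a => hCf _))
    (hf't.stronglyMeasurable.comp_measurable (hφ t htU)).aestronglyMeasurable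
    (.of_forall fun a s hs => hC s hs _) (integrable_const C)
    (.of_forall fun a s hs => ?_)).2
  exact (hf.differentiable one_ne_zero _).hasFDerivAt.comp_hasDerivAt s (hode a s (hJU hs))

end Transport

namespace IsContinuousDAE

open scoped ContDiff Laplacian

variable {m : ℕ} {F : Type*} [NormedAddCommGroup F] [NormedSpace ℝ F] {f : Ground m → F}
  {P : Measure (Ground m)} [IsFiniteMeasure P] {T t : ℝ} {φ : ℝ → Ground m → Ground m}

theorem hasDerivAt_integral (h : IsContinuousDAE P T φ) (ht : t ∈ Ioo 0 T)
    (hf : ContDiff ℝ 2 f) (hsupp : HasCompactSupport f) :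
    HasDerivAt (fun s => ∫ x, f (φ s x) ∂P) (-∫ x, Δ f (φ t x) ∂P) t := by
  obtain ⟨-, hφ, ρ, hρ, hV, hode⟩ := h
  have htI : t ∈ Ico 0 T := Ioo_subset_Ico_self ht
  obtain ⟨hpos, hd, hmap⟩ := hρ t htI
  have hscore : Continuous (score (ρ t)) := continuousOn_univ.1 <|
    hV.comp (f := fun y : Ground m => (t, y)) (by fun_prop) fun y _ => ⟨htI, mem_univ y⟩
  have hderiv := hasDerivAt_integral_comp_flow (P := P) (f := f) (V := fun s => score (ρ s))
    (Ioo_mem_nhds ht.1 ht.2) (fun s hs => hφ s (Ioo_subset_Ico_self hs))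
    (hV.mono (prod_mono_left Ioo_subset_Ico_self))
    (fun x s hs => (hode x s (Ioo_subset_Ico_self hs)).hasDerivAt (Ico_mem_nhds hs.1 hs.2))
    (hf.of_le one_le_two) hsupp
  convert! hderiv using 1
  rw [← integral_map (hφ t htI).aemeasurable (continuous_laplacian hf).aestronglyMeasurable,
    ← integral_map (f := fun y => fderiv ℝ f y (score (ρ t) y)) (hφ t htI).aemeasurable
      ((hf.continuous_fderiv two_ne_zero).clm_apply hscore).aestronglyMeasurable, hmap,
    integral_fderiv_score_withDensity hpos hd hscore hf hsupp]

theorem continuousOn_integral (h : IsContinuousDAE P T φ) (hf : Continuous f) {C : ℝ}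
    (hC : ∀ x, ‖f x‖ ≤ C) : ContinuousOn (fun s => ∫ x, f (φ s x) ∂P) (Ico 0 T) := by
  obtain ⟨-, hφ, ρ, -, -, hode⟩ := h
  exact continuousOn_of_dominated (bound := fun _ => C)
    (fun s hs => (hf.stronglyMeasurable.comp_measurable (hφ s hs)).aestronglyMeasurable)
    (fun s _ => .of_forall fun x => hC _) (integrable_const C)
    (.of_forall fun x => hf.comp_continuousOn fun s hs => (hode x s hs).continuousWithinAt)

theorem norm_exp_smul_integral_sub_le (h : IsContinuousDAE P T φ) (ht : t ∈ Ico 0 T)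
    (hf : ContDiff ℝ 2 f) (hsupp : HasCompactSupport f) {l c : ℝ} (hl : 0 ≤ l)
    (hc : ∀ x, ‖Δ f x + l • f x‖ ≤ c) :
    ‖Real.exp (-(l * t)) • ∫ x, f (φ t x) ∂P - ∫ x, f x ∂P‖ ≤ t * (c * P.real univ) := by
  obtain ⟨Cf, hCf⟩ := hsupp.exists_bound_of_continuous hf.continuous
  obtain ⟨CΔ, hCΔ⟩ := (hasCompactSupport_laplacian hsupp).exists_bound_of_continuous
    (continuous_laplacian hf)
  have hsub : Icc 0 t ⊆ Ico 0 T := Icc_subset_Ico_right ht.2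
  have hderiv (s) (hs : s ∈ Ioo 0 t) :
      HasDerivAt (fun s => Real.exp (-(l * s)) • ∫ x, f (φ s x) ∂P)
        (-(Real.exp (-(l * s)) • ∫ x, (Δ f (φ s x) + l • f (φ s x)) ∂P)) s := by
    have hsm := h.2.1 s (hsub (Ioo_subset_Icc_self hs))
    have hexp : HasDerivAt (fun s => Real.exp (-(l * s))) (Real.exp (-(l * s)) * -(l * 1)) s :=
      ((hasDerivAt_id' s).const_mul l).fun_neg.exp
    have hΔint : Integrable (fun x => Δ f (φ s x)) P :=
      .of_bound ((continuous_laplacian hf).stronglyMeasurable.comp_measurable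
        hsm).aestronglyMeasurable CΔ (.of_forall fun x => hCΔ _)
    have hfint : Integrable (fun x => f (φ s x)) P :=
      .of_bound (hf.continuous.stronglyMeasurable.comp_measurable hsm).aestronglyMeasurable Cf
        (.of_forall fun x => hCf _)
    convert! hexp.smul (h.hasDerivAt_integral ⟨hs.1, hs.2.trans ht.2⟩ hf hsupp) using 1
    rw [integral_add hΔint (hfint.fun_smul l), integral_smul]
    module
  have hbound (s) (hs : s ∈ Ioo 0 t) :
      ‖deriv (fun s => Real.exp (-(l * s)) • ∫ x, f (φ s x) ∂P) s‖ ≤ c * P.real univ := by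
    rw [(hderiv s hs).deriv, norm_neg, norm_smul, Real.norm_of_nonneg (Real.exp_pos _).le]
    have hint := norm_integral_le_of_norm_le_const (μ := P) (.of_forall fun x => hc (φ s x))
    refine (mul_le_of_le_one_left (norm_nonneg _) (Real.exp_le_one_iff.2 ?_)).trans hint
    exact neg_nonpos.2 (mul_nonneg hl hs.1.le)
  have hle := norm_sub_le_integral_of_norm_deriv_le_of_le (B := fun _ => c * P.real univ) ht.1
    ((by fun_prop : Continuous fun s => Real.exp (-(l * s))).continuousOn.smul
      ((h.continuousOn_integral hf.continuous hCf).mono hsub))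
    (fun s hs => (hderiv s hs).differentiableAt.differentiableWithinAt)
    (.of_forall hbound) (by simp)
  simpa [h.1, mul_left_comm] using hle

theorem exp_mul_charFun_map (h : IsContinuousDAE P T φ) (ht : t ∈ Ico 0 T) (ξ : Ground m) :
    Real.exp (-(‖ξ‖ ^ 2 * t)) * charFun (P.map (φ t)) ξ = charFun P ξ := by
  obtain ⟨C, hC⟩ := exists_norm_laplacian_cutoffWave_add_le ξ
  have hlim {Q : Measure (Ground m)} [IsFiniteMeasure Q] :
      Filter.Tendsto (fun ε => ∫ x, cutoffWave ξ ε x ∂Q) (𝓝[>] 0) (𝓝 (charFun Q ξ)) := by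
    rw [charFun_eq_integral_innerProbChar]
    exact tendsto_integral_filter_of_dominated_convergence (fun _ => 1)
      (.of_forall fun ε => (contDiff_cutoffWave ξ ε (n := 0)).continuous.aestronglyMeasurable)
      (.of_forall fun ε => .of_forall fun x => norm_cutoffWave_le_one ξ ε x) (integrable_const 1)
      (.of_forall fun x => (tendsto_cutoffWave ξ x).mono_left nhdsWithin_le_nhds)
  have hle : ∀ᶠ ε in 𝓝[>] (0 : ℝ), ‖Real.exp (-(‖ξ‖ ^ 2 * t)) •
      ∫ x, cutoffWave ξ ε x ∂(P.map (φ t)) - ∫ x, cutoffWave ξ ε x ∂P‖ ≤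
      t * (ε * C * P.real univ) := by
    filter_upwards [Ioc_mem_nhdsGT one_pos] with ε hε
    have hf := contDiff_cutoffWave ξ ε (n := 2)
    rw [integral_map (h.2.1 t ht).aemeasurable hf.continuous.aestronglyMeasurable]
    refine h.norm_exp_smul_integral_sub_le ht hf (hasCompactSupport_cutoffWave ξ hε.1.ne')
      (sq_nonneg _) fun x => ?_
    simpa using hC ε hε x
  have hzero : Filter.Tendsto (fun ε : ℝ => t * (ε * C * P.real univ)) (𝓝[>] 0) (𝓝 0) := by
    have : Continuous fun ε : ℝ => t * (ε * C * P.real univ) := by fun_prop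
    simpa using (this.tendsto 0).mono_left nhdsWithin_le_nhds
  have := le_of_tendsto_of_tendsto ((hlim.const_smul _).sub hlim).norm hzero hle
  simpa [sub_eq_zero] using this

end IsContinuousDAE

/-! ### The continuous DAE -/

section Law

variable {m K : ℕ}

namespace GaussianMixture

variable (G : GaussianMixture m K) {S : Fin K → Matrix (Fin m) (Fin m) ℝ}

theorem charFun_gaussianSum (hS : ∀ k, (S k).PosSemidef) (ξ : Ground m) :
    charFun (gaussianSum G.weight G.mean S) ξ = ∑ k, G.weight k *
      Complex.exp (inner ℝ ξ (G.mean k) * Complex.I - inner ℝ ξ (matAct (S k) ξ) / 2) := by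
  rw [charFun_apply, integral_gaussianSum G.weight_nonneg fun k => .of_bound (C := 1)
    (by fun_prop) (.of_forall fun x => (Complex.norm_exp_ofReal_mul_I _).le)]
  refine Finset.sum_congr rfl fun k _ => ?_
  rw [← charFun_apply, charFun_multivariateGaussian (hS k), inner_matAct, Complex.real_smul]

theorem exp_mul_charFun_gaussianSum_contCov {t : ℝ} (h : ∀ k, (G.contCov t k).PosSemidef)
    (ξ : Ground m) :
    Real.exp (-(‖ξ‖ ^ 2 * t)) * charFun (gaussianSum G.weight G.mean (G.contCov t)) ξ =
      charFun G.law ξ := by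
  rw [law, G.charFun_gaussianSum h, G.charFun_gaussianSum fun k => (G.cov_posDef k).posSemidef,
    Finset.mul_sum]
  refine Finset.sum_congr rfl fun k _ => ?_
  rw [mul_left_comm, Complex.ofReal_exp, ← Complex.exp_add, contCov, sub_matAct, inner_sub_right,
    inner_smul_one_matAct_self]
  congr 2
  push_cast
  ring

theorem map_of_isContinuousDAE {T t : ℝ} {φ : ℝ → Ground m → Ground m}
    (h : IsContinuousDAE G.law T φ) (ht : t ∈ Ico 0 T) (hpos : ∀ k, (G.contCov t k).PosSemidef) :
    G.law.map (φ t) = gaussianSum G.weight G.mean (G.contCov t) := by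
  refine Measure.ext_of_charFun (funext fun ξ => ?_)
  refine mul_left_cancel₀ (Complex.ofReal_ne_zero.2 (Real.exp_pos (-(‖ξ‖ ^ 2 * t))).ne') ?_
  rw [h.exp_mul_charFun_map ht, G.exp_mul_charFun_gaussianSum_contCov hpos]

theorem hasDerivWithinAt_of_isContinuousDAE {T t : ℝ} {φ : ℝ → Ground m → Ground m}
    (h : IsContinuousDAE G.law T φ) (ht : t ∈ Ico 0 T) (hpos : ∀ k, (G.contCov t k).PosDef)
    (x : Ground m) :
    HasDerivWithinAt (fun s => φ s x) (score (G.mixDensity (G.contCov t)) (φ t x)) (Ico 0 T) t := by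
  have hmap := G.map_of_isContinuousDAE h ht fun k => (hpos k).posSemidef
  obtain ⟨-, -, ρ, hρ, -, hode⟩ := h
  obtain ⟨hρ0, hd, hρmap⟩ := hρ t ht
  rw [hρmap, G.gaussianSum_eq_withDensity hpos] at hmap
  rw [← eq_of_withDensity_ofReal_eq hd.continuous (G.continuous_mixDensity _)
    (fun y => (hρ0 y).le) (fun y => (G.mixDensity_pos hpos y).le) hmap]
  exact hode x t ht

end GaussianMixture

end Law

section NearCenter

variable {m K : ℕ}

theorem mahalanobisSq_le_of_norm_sq_le {S : Matrix (Fin m) (Fin m) ℝ} {κ c : ℝ} {μ x : Ground m}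
    (hS : S.PosDef) (hκ : 0 < κ) (hκS : κ • 1 ≤ S) (h : ‖x - μ‖ ^ 2 ≤ κ * c) :
    mahalanobisSq μ S x ≤ c :=
  le_of_mul_le_mul_left ((mul_mahalanobisSq_le_norm_sq_sub hS hκS μ x).trans h) hκ

namespace GaussianMixture

variable (G : GaussianMixture m K) {S : Fin K → Matrix (Fin m) (Fin m) ℝ} {j k : Fin K}
  {κ c ε : ℝ} {x : Ground m}

theorem peakRatioSq_mul_exp_le (hS : ∀ k, (S k).PosDef) (hjk : j ≠ k) (hk : G.weight k ≠ 0)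
    (hε : ε ≤ 1 / 2) (h : 1 - ε ≤ G.resp S k (G.mean k)) :
    G.peakRatioSq S j k * Real.exp (-mahalanobisSq (G.mean j) (S j) (G.mean k)) ≤ 4 * ε ^ 2 := by
  have hγj := pow_le_pow_left₀ (G.resp_nonneg hS j _) (G.resp_le_of_ne hS hjk h) 2
  have hγk : (1 / 2) ^ 2 ≤ G.resp S k (G.mean k) ^ 2 :=
    pow_le_pow_left₀ (by norm_num) (by linarith) 2
  have hcenter : mahalanobisSq (G.mean k) (S k) (G.mean k) = 0 := by
    simp [mahalanobisSq_eq_inner]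
  rw [G.resp_sq_eq hS j hk, hcenter, zero_sub] at hγj
  have hq := mul_nonneg (G.peakRatioSq_nonneg hS j k)
    (Real.exp_pos (-mahalanobisSq (G.mean j) (S j) (G.mean k))).le
  linarith [mul_le_mul_of_nonneg_left hγk hq]

theorem resp_sq_le_mul_exp (hS : ∀ k, (S k).PosDef) (j : Fin K) (hk : G.weight k ≠ 0)
    (hκ : 0 < κ) (hκk : κ • 1 ≤ S k) (hx : ‖x - G.mean k‖ ^ 2 ≤ κ * c) :
    G.resp S j x ^ 2 ≤ G.peakRatioSq S j k * Real.exp c *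
      Real.exp (-mahalanobisSq (G.mean j) (S j) x) := by
  refine (G.resp_sq_le hS j hk x).trans ?_
  rw [mul_assoc, ← Real.exp_add, ← sub_eq_add_neg]
  have hq := G.peakRatioSq_nonneg hS j k
  have hD := mahalanobisSq_le_of_norm_sq_le (hS k) hκ hκk hx
  gcongr

/-- Splitting `γⱼ⁴` into two copies of `γⱼ²`, the Gaussian tail at `x` can be traded for the one at
the center `μₖ`, where well-separation makes the latter small. -/
theorem resp_pow_four_le (hS : ∀ k, (S k).PosDef) (hk : G.weight k ≠ 0) (hκ : 0 < κ)
    (hκj : κ • 1 ≤ S j) (hκk : κ • 1 ≤ S k) (hx : ‖x - G.mean k‖ ^ 2 ≤ κ * c) :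
    G.resp S j x ^ 4 ≤ G.peakRatioSq S j k * Real.exp (4 * c) *
      (G.peakRatioSq S j k * Real.exp (-mahalanobisSq (G.mean j) (S j) (G.mean k))) := by
  set q := G.peakRatioSq S j k
  set D := mahalanobisSq (G.mean j) (S j) x
  have hq : 0 ≤ q := G.peakRatioSq_nonneg hS j k
  have hD : mahalanobisSq (G.mean j) (S j) (G.mean k) ≤ 2 * D + 2 * c := by
    refine (mahalanobisSq_le_two_mul_add (hS j) _ _ x).trans ?_
    rw [norm_sub_rev] at hx
    linarith [mahalanobisSq_le_of_norm_sq_le (hS j) hκ hκj hx]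
  calc G.resp S j x ^ 4 = (G.resp S j x ^ 2) ^ 2 := by ring
    _ ≤ (q * Real.exp c * Real.exp (-D)) ^ 2 :=
      pow_le_pow_left₀ (sq_nonneg _) (G.resp_sq_le_mul_exp hS j hk hκ hκk hx) 2
    _ = q * Real.exp (4 * c) * (q * Real.exp (-(2 * D + 2 * c))) := by
      rw [mul_pow, mul_pow, ← Real.exp_nat_mul, ← Real.exp_nat_mul, mul_assoc (q ^ 2),
        ← Real.exp_add, mul_mul_mul_comm, ← Real.exp_add, sq]
      congr 2
      push_cast
      ring
    _ ≤ _ := by gcongr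

/-- The constant in the bound for the fourth power of a responsibility near a center: `exp (4 * c)`
is the cost of moving to the center, `(R / κ) ^ m / w ^ 2` bounds the ratio of peak heights, and `4`
comes from the separation at the center. -/
noncomputable def centerTailConst (m : ℕ) (κ R w c : ℝ) : ℝ :=
  4 * ((R / κ) ^ m / w ^ 2) * Real.exp (4 * c)

theorem resp_pow_four_le_mul_centerTailConst {R w : ℝ} (hS : ∀ k, (S k).PosDef) (hκ : 0 < κ)
    (hw : 0 < w) (hκS : ∀ k, κ • 1 ≤ S k) (hR : S k ≤ R • 1) (hjk : j ≠ k) (hk : w ≤ G.weight k)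
    (hε0 : 0 ≤ ε) (hε : ε ≤ 1 / 2) (hresp : 1 - ε ≤ G.resp S k (G.mean k))
    (hx : ‖x - G.mean k‖ ^ 2 ≤ κ * c) :
    G.resp S j x ^ 4 ≤ ε * centerTailConst m κ R w c := by
  have hk0 : G.weight k ≠ 0 := (hw.trans_le hk).ne'
  have hq0 := G.peakRatioSq_nonneg hS j k
  have hq := G.peakRatioSq_le hS hκ hw (hκS j) hR hk
  have hQ0 := hq0.trans hq
  calc G.resp S j x ^ 4 ≤ _ := G.resp_pow_four_le hS hk0 hκ (hκS j) (hκS k) hx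
    _ ≤ (R / κ) ^ m / w ^ 2 * Real.exp (4 * c) * (4 * ε ^ 2) :=
      mul_le_mul (by gcongr) (G.peakRatioSq_mul_exp_le hS hjk hk0 hε hresp) (by positivity)
        (by positivity)
    _ ≤ (R / κ) ^ m / w ^ 2 * Real.exp (4 * c) * (4 * ε) := by
      gcongr
      exact pow_le_of_le_one hε0 (by linarith) two_ne_zero
    _ = ε * centerTailConst m κ R w c := by unfold centerTailConst; ring

theorem resp_mul_norm_pow_six_le {R w : ℝ} (hS : ∀ k, (S k).PosDef) (hκ : 0 < κ) (hw : 0 < w)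
    (hκS : ∀ k, κ • 1 ≤ S k) (hR : S k ≤ R • 1) (hjk : j ≠ k) (hk : w ≤ G.weight k)
    (hε0 : 0 ≤ ε) (hε : ε ≤ 1 / 2) (hresp : 1 - ε ≤ G.resp S k (G.mean k))
    (hx : ‖x - G.mean k‖ ^ 2 ≤ κ * c) :
    (G.resp S j x * ‖matAct (S j)⁻¹ (x - G.mean j)‖) ^ 6 ≤ ε * (centerTailConst m κ R w c *
      ((R / κ) ^ m / w ^ 2 * Real.exp c * κ⁻¹ ^ 3 * Nat.factorial 3)) := by
  have hq0 := G.peakRatioSq_nonneg hS j k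
  have hq := G.peakRatioSq_le hS hκ hw (hκS j) hR hk
  have hQ0 := hq0.trans hq
  have hγ : G.resp S j x ^ 2 ≤ (R / κ) ^ m / w ^ 2 * Real.exp c *
      Real.exp (-mahalanobisSq (G.mean j) (S j) x) :=
    (G.resp_sq_le_mul_exp hS j (hw.trans_le hk).ne' hκ (hκS k) hx).trans (by gcongr)
  have ha : ‖matAct (S j)⁻¹ (x - G.mean j)‖ ^ 2 ≤ κ⁻¹ * mahalanobisSq (G.mean j) (S j) x := by
    rw [mahalanobisSq_eq_inner, ← div_eq_inv_mul, le_div_iff₀' hκ]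
    exact mul_norm_sq_matAct_inv_le (hS j) (hκS j) _
  have hA0 : 0 ≤ centerTailConst m κ R w c := by unfold centerTailConst; positivity
  refine (mul_pow_le_of_sq_le_mul_exp_neg (n := 2) (mul_nonneg hε0 hA0) (by positivity)
    (by positivity) (mahalanobisSq_nonneg (hS j) _ x)
    (G.resp_pow_four_le_mul_centerTailConst hS hκ hw hκS hR hjk hk hε0 hε hresp hx) hγ
    ha).trans_eq ?_
  rw [mul_assoc]

theorem exists_norm_score_add_le (m K : ℕ) {κ R w η : ℝ} (b : ℝ) (hκ : 0 < κ) (hw : 0 < w)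
    (hη : 0 < η) :
    ∃ ε : ℝ, 0 < ε ∧ ∀ (G : GaussianMixture m K) (S : Fin K → Matrix (Fin m) (Fin m) ℝ),
      (∀ k, (S k).PosDef) → (∀ k, κ • 1 ≤ S k) → ∀ k x, S k ≤ R • 1 → w ≤ G.weight k →
        1 - ε ≤ G.resp S k (G.mean k) → ‖x - G.mean k‖ ≤ b →
          ‖score (G.mixDensity S) x + matAct (S k)⁻¹ (x - G.mean k)‖ ≤ η := by
  set c : ℝ := b ^ 2 / κ
  set A : ℝ := centerTailConst m κ R w c
  set a : ℝ := η / (2 * (K + 1))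
  have ha : 0 < a := by positivity
  obtain ⟨ε, ⟨⟨hε, hεk⟩, hεj⟩, hε0 : 0 < ε⟩ :=
    (((eventually_mul_le 1 one_half_pos).and
      (eventually_mul_le (A * (b / κ) ^ 4) (pow_pos ha 4))).and
      (eventually_mul_le (A * ((R / κ) ^ m / w ^ 2 * Real.exp c * κ⁻¹ ^ 3 * Nat.factorial 3))
        (pow_pos ha 6))).and self_mem_nhdsWithin |>.exists
  rw [mul_one] at hε
  refine ⟨ε, hε0, fun G S hS hκS k x hR hk hresp hx => ?_⟩
  have hxc : ‖x - G.mean k‖ ^ 2 ≤ κ * c := by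
    rw [mul_div_cancel₀ _ hκ.ne']
    gcongr
  have hcenter : ‖matAct (S k)⁻¹ (x - G.mean k)‖ ≤ b / κ := by
    rw [le_div_iff₀' hκ]
    exact (mul_norm_matAct_inv_le (hS k) hκ.le (hκS k) _).trans hx
  calc ‖score (G.mixDensity S) x + matAct (S k)⁻¹ (x - G.mean k)‖ ≤ K * (a + a) := by
        refine G.norm_score_mixDensity_add_le hS ha.le ha.le (fun j hj => ?_) fun j hj => ?_
        · have hγ := G.resp_pow_four_le_mul_centerTailConst hS hκ hw hκS hR hj hk hε0.le hε hresp
            hxc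
          have hA0 : 0 ≤ ε * A := (pow_nonneg (G.resp_nonneg hS j x) 4).trans hγ
          refine le_of_pow_le_pow_left₀ four_ne_zero ha.le (le_trans ?_ hεk)
          rw [mul_pow, ← mul_assoc]
          gcongr
        · exact le_of_pow_le_pow_left₀ (by norm_num) ha.le ((G.resp_mul_norm_pow_six_le hS hκ hw
            hκS hR hj hk hε0.le hε hresp hxc).trans hεj)
    _ ≤ (K + 1) * (a + a) := by gcongr; linarith
    _ = η := by simp only [a]; field_simp; norm_num

end GaussianMixture

end NearCenter

section AffineFlow

theorem matAct_eq_sum {m : ℕ} {ι : Type*} [Fintype ι] {A : Matrix (Fin m) (Fin m) ℝ} {c : ι → ℝ}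
    (b : OrthonormalBasis ι ℝ (Ground m)) (h : ∀ i, matAct A (b i) = c i • b i) (v : Ground m) :
    matAct A v = ∑ i, (c i * inner ℝ (b i) v) • b i := by
  conv_lhs => rw [← b.sum_repr' v, matAct_eq_toEuclideanCLM, map_sum]
  refine Finset.sum_congr rfl fun i _ => ?_
  rw [← matAct_eq_toEuclideanCLM, matAct_smul, h, smul_smul, mul_comm]

section Eigenvectors

variable {m : ℕ} {A : Matrix (Fin m) (Fin m) ℝ} {c : ℝ} {v : Ground m}

theorem matAct_inv_of_eigenvector (hA : IsUnit A) (hc : c ≠ 0) (h : matAct A v = c • v) :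
    matAct A⁻¹ v = c⁻¹ • v := by
  rw [eq_inv_smul_iff₀ hc, ← matAct_smul, ← h, matAct_inv_matAct hA]

theorem matAct_sqrt_of_eigenvector (hA : A.PosSemidef) (hc : 0 < c) (h : matAct A v = c • v) :
    matAct (CFC.sqrt A) v = √c • v := by
  set w := matAct (CFC.sqrt A) v - √c • v with hw
  have hneg : matAct (CFC.sqrt A) w = -(√c • w) := by
    rw [hw, matAct_sub, matAct_smul, ← mul_matAct, CFC.sqrt_mul_sqrt_self A hA.nonneg, h, smul_sub,
      smul_smul, Real.mul_self_sqrt hc.le, neg_sub]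
  have hnonneg := inner_matAct_self_nonneg (posSemidef_sqrt A) w
  rw [hneg, inner_neg_right, inner_smul_right, neg_nonneg] at hnonneg
  exact sub_eq_zero.1 (real_inner_self_nonpos.1
    (nonpos_of_mul_nonpos_right hnonneg (Real.sqrt_pos.2 hc)))

theorem matAct_eigenvectorBasis (hA : A.IsHermitian) (i : Fin m) :
    matAct A (hA.eigenvectorBasis i) = hA.eigenvalues i • hA.eigenvectorBasis i := by
  rw [matAct, hA.mulVec_eigenvectorBasis]; rfl

end Eigenvectors

theorem hasDerivAt_sqrt_one_sub_div {σ s : ℝ} (hσ : 0 < σ) (hs : 0 < σ - 2 * s) :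
    HasDerivAt (fun s => √(1 - 2 * s / σ)) (-((σ - 2 * s)⁻¹ * √(1 - 2 * s / σ))) s := by
  have hratio : 1 - 2 * s / σ = (σ - 2 * s) / σ := by field_simp
  have hpos : 0 < 1 - 2 * s / σ := hratio ▸ div_pos hs hσ
  have hinner : HasDerivAt (fun s : ℝ => 1 - 2 * s / σ) (-(2 / σ)) s := by
    simpa using (((hasDerivAt_id s).const_mul 2).div_const σ).const_sub 1
  refine (hinner.sqrt hpos.ne').congr_deriv ?_
  have hinv : (σ - 2 * s)⁻¹ = (σ * √(1 - 2 * s / σ) ^ 2)⁻¹ := by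
    rw [Real.sq_sqrt hpos.le, hratio, mul_div_cancel₀ _ hσ.ne']
  rw [hinv]
  field_simp [(Real.sqrt_pos.2 hpos).ne']

namespace GaussianMixture

variable {m K : ℕ} (G : GaussianMixture m K)

theorem contCov_anti {s t : ℝ} (hst : s ≤ t) (k : Fin K) : G.contCov t k ≤ G.contCov s k := by
  exact sub_le_sub_left (smul_le_smul_of_nonneg_right (by linarith) zero_le_one) _

@[simp] theorem contCov_zero (k : Fin K) : G.contCov 0 k = G.cov k := by simp [contCov]

theorem contCov_le_cov {s : ℝ} (h0 : 0 ≤ s) (k : Fin K) : G.contCov s k ≤ G.cov k :=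
  G.contCov_zero k ▸ G.contCov_anti h0 k

theorem smul_one_le_contCov_iff {a s : ℝ} (k : Fin K) :
    a • 1 ≤ G.contCov s k ↔ (a + 2 * s) • 1 ≤ G.cov k := by
  rw [contCov, le_sub_iff_add_le, add_smul]

theorem eigenvalues_sub_pos {s : ℝ} {k : Fin K} (hs : (G.contCov s k).PosDef) (i : Fin m) :
    0 < (G.cov_posDef k).1.eigenvalues i - 2 * s := by
  obtain ⟨c, hc, hcS⟩ := exists_pos_smul_one_le hs
  linarith [le_eigenvalues (G.cov_posDef k).1 ((G.smul_one_le_contCov_iff k).1 hcS) i]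

theorem eventually_posDef_contCov {s : ℝ} {k : Fin K} (hs : (G.contCov s k).PosDef) :
    ∀ᶠ s' in 𝓝 s, (G.contCov s' k).PosDef := by
  obtain ⟨c, hc, hcS⟩ := exists_pos_smul_one_le hs
  filter_upwards [Iio_mem_nhds (show s < s + c / 2 by linarith)] with s' hs'
  refine posDef_of_smul_one_le (κ := c - 2 * (s' - s)) (by linarith [mem_Iio.1 hs']) ?_
  rw [smul_one_le_contCov_iff] at hcS ⊢
  convert hcS using 2
  ring

theorem matAct_contCov_eigenvectorBasis (s : ℝ) (k : Fin K) (i : Fin m) :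
    matAct (G.contCov s k) ((G.cov_posDef k).1.eigenvectorBasis i) =
      ((G.cov_posDef k).1.eigenvalues i - 2 * s) • (G.cov_posDef k).1.eigenvectorBasis i := by
  rw [contCov, sub_matAct, smul_matAct, one_matAct, matAct_eigenvectorBasis, sub_smul]

theorem contAffine_sub_mean_eq_sum {s : ℝ} {k : Fin K} (hs : (G.contCov s k).PosDef)
    (x : Ground m) :
    G.contAffine s k x - G.mean k =
      ∑ i, (√(1 - 2 * s / (G.cov_posDef k).1.eigenvalues i) *
        inner ℝ ((G.cov_posDef k).1.eigenvectorBasis i) (x - G.mean k)) •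
          (G.cov_posDef k).1.eigenvectorBasis i := by
  have hcov := G.cov_posDef k
  rw [contAffine, add_sub_cancel_right]
  refine matAct_eq_sum _ (fun i => ?_) _
  have hσ := hcov.eigenvalues_pos i
  refine matAct_sqrt_of_eigenvector
    (posSemidef_one_sub_smul_inv hcov (G.smul_one_le_cov hs.posSemidef)) ?_ ?_
  · rw [sub_pos, div_lt_one hσ]
    linarith [G.eigenvalues_sub_pos hs i]
  · rw [sub_matAct, smul_matAct, one_matAct,
      matAct_inv_of_eigenvector hcov.isUnit hσ.ne' (matAct_eigenvectorBasis hcov.1 i), smul_smul,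
      sub_smul, one_smul, div_eq_mul_inv]

-- The derivative is the score of `N(μₖ, Σₖ - 2sI)` at the moving point: the affine model is the
-- continuous DAE trained for the single Gaussian `N(μₖ, Σₖ)`.
theorem hasDerivAt_contAffine {s : ℝ} {k : Fin K} (hs : (G.contCov s k).PosDef) (x : Ground m) :
    HasDerivAt (fun s => G.contAffine s k x)
      (-matAct (G.contCov s k)⁻¹ (G.contAffine s k x - G.mean k)) s := by
  have hsum : HasDerivAt (fun s => G.contAffine s k x - G.mean k) _ s :=
    (HasDerivAt.fun_sum fun i (_ : i ∈ Finset.univ) =>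
      ((hasDerivAt_sqrt_one_sub_div ((G.cov_posDef k).eigenvalues_pos i)
        (G.eigenvalues_sub_pos hs i)).mul_const _).smul_const _).congr_of_eventuallyEq
      ((G.eventually_posDef_contCov hs).mono fun s' hs' => G.contAffine_sub_mean_eq_sum hs' x)
  refine ((hasDerivAt_sub_const_iff _).1 hsum).congr_deriv ?_
  rw [matAct_eq_sum _ (fun i => matAct_inv_of_eigenvector hs.isUnit
    (G.eigenvalues_sub_pos hs i).ne' (G.matAct_contCov_eigenvectorBasis s k i)),
    G.contAffine_sub_mean_eq_sum hs x, ← Finset.sum_neg_distrib]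
  refine Finset.sum_congr rfl fun i _ => ?_
  rw [(G.cov_posDef k).1.eigenvectorBasis.orthonormal.inner_right_fintype, ← neg_smul, neg_mul,
    mul_assoc]

theorem norm_contAffine_sub_mean_le {s : ℝ} (h0 : 0 ≤ s) {k : Fin K}
    (hs : (G.contCov s k).PosSemidef) (x : Ground m) :
    ‖G.contAffine s k x - G.mean k‖ ≤ ‖x - G.mean k‖ := by
  have hcov := G.cov_posDef k
  refine le_of_sq_le_sq ?_ (norm_nonneg _)
  rw [contAffine, add_sub_cancel_right,
    norm_sq_matAct_sqrt (posSemidef_one_sub_smul_inv hcov (G.smul_one_le_cov hs)), sub_matAct,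
    smul_matAct, one_matAct, inner_sub_right, inner_smul_right, real_inner_self_eq_norm_sq]
  exact sub_le_self _ (mul_nonneg (by linarith)
    (inner_matAct_self_nonneg hcov.inv.posSemidef (x - G.mean k)))

@[simp] theorem contAffine_zero (k : Fin K) (x : Ground m) : G.contAffine 0 k x = x := by
  simp [contAffine]

end GaussianMixture

end AffineFlow

section Stability

theorem norm_le_of_norm_deriv_right_le_add_mul {E : Type*} [NormedAddCommGroup E] [NormedSpace ℝ E]
    {f f' : ℝ → E} {t η L δ : ℝ} (ht : 0 ≤ t) (hL : 0 ≤ L) (hδ : 0 ≤ δ)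
    (hη : η < δ * Real.exp (-((L + 1) * t))) (hf : ContinuousOn f (Icc 0 t))
    (hf' : ∀ s ∈ Ico 0 t, HasDerivWithinAt f (f' s) (Ici s) s) (hf0 : f 0 = 0)
    (hbound : ∀ s ∈ Ico 0 t, ‖f s‖ ≤ δ → ‖f' s‖ ≤ η + L * ‖f s‖) : ‖f t‖ ≤ δ := by
  have hB : ∀ s, HasDerivAt (fun s => δ * Real.exp ((L + 1) * (s - t)))
      ((L + 1) * (δ * Real.exp ((L + 1) * (s - t)))) s := fun s => by
    have hlin : HasDerivAt (fun s : ℝ => (L + 1) * (s - t)) (L + 1) s := by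
      simpa using ((hasDerivAt_id s).sub_const t).const_mul (L + 1)
    exact (hlin.exp.const_mul δ).congr_deriv (by ring)
  have h := image_norm_le_of_norm_deriv_right_lt_deriv_boundary'
    (B := fun s => δ * Real.exp ((L + 1) * (s - t))) hf hf' (by rw [hf0, norm_zero]; positivity)
    (fun s _ => (hB s).continuousAt.continuousWithinAt) (fun s _ => (hB s).hasDerivWithinAt)
    (fun s hs heq => ?_) (right_mem_Icc.2 ht)
  · simpa using h
  · have hle : δ * Real.exp ((L + 1) * (s - t)) ≤ δ :=
      mul_le_of_le_one_right hδ (Real.exp_le_one_iff.2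
        (mul_nonpos_of_nonneg_of_nonpos (by linarith) (by linarith [hs.2])))
    have hlt : η < δ * Real.exp ((L + 1) * (s - t)) := by
      refine hη.trans_le ?_
      gcongr
      nlinarith [hs.1]
    have := hbound s hs (heq.trans_le hle)
    rw [heq] at this
    linarith

namespace GaussianMixture

variable {m K : ℕ} (G : GaussianMixture m K)

theorem norm_sub_contAffine_le {T t κ η b δ : ℝ} {φ : ℝ → Ground m → Ground m} {k : Fin K}
    {x : Ground m} (hφ : IsContinuousDAE G.law T φ) (ht : t ∈ Ico 0 T) (hκ : 0 < κ) (hδ : 0 ≤ δ)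
    (hκt : ∀ j, κ • 1 ≤ G.contCov t j) (hη : η < δ * Real.exp (-((κ⁻¹ + 1) * t)))
    (hx : ‖x - G.mean k‖ ≤ b)
    (hscore : ∀ s ∈ Icc 0 t, ∀ y, ‖y - G.mean k‖ ≤ δ + b →
      ‖score (G.mixDensity (G.contCov s)) y + matAct (G.contCov s k)⁻¹ (y - G.mean k)‖ ≤ η) :
    ‖φ t x - G.contAffine t k x‖ ≤ δ := by
  have hκs : ∀ s ∈ Icc 0 t, ∀ j, κ • 1 ≤ G.contCov s j := fun s hs j =>
    (hκt j).trans (G.contCov_anti hs.2 j)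
  have hpos : ∀ s ∈ Icc 0 t, ∀ j, (G.contCov s j).PosDef := fun s hs j =>
    posDef_of_smul_one_le hκ (hκs s hs j)
  have hT : Icc 0 t ⊆ Ico 0 T := Icc_subset_Ico_right ht.2
  have hode : ∀ s ∈ Icc 0 t, HasDerivWithinAt (fun s => φ s x - G.contAffine s k x)
      (score (G.mixDensity (G.contCov s)) (φ s x) -
        -matAct (G.contCov s k)⁻¹ (G.contAffine s k x - G.mean k)) (Ico 0 T) s := fun s hs =>
    (G.hasDerivWithinAt_of_isContinuousDAE hφ (hT hs) (hpos s hs) x).sub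
      (G.hasDerivAt_contAffine (hpos s hs k) x).hasDerivWithinAt
  refine norm_le_of_norm_deriv_right_le_add_mul (f := fun s => φ s x - G.contAffine s k x)
    ht.1 (inv_nonneg.2 hκ.le) hδ hη (fun s hs => (hode s hs).continuousWithinAt.mono hT)
    (fun s hs => (hode s (Ico_subset_Icc_self hs)).mono_of_mem_nhdsWithin
      (Filter.mem_of_superset (Ico_mem_nhdsGE (hs.2.trans ht.2)) (Ico_subset_Ico_left hs.1)))
    (by rw [hφ.1, contAffine_zero, sub_self]) fun s hs htube => ?_
  have hsI := Ico_subset_Icc_self hs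
  set y := φ s x
  set z := G.contAffine s k x
  have hy : ‖y - G.mean k‖ ≤ δ + b := by
    rw [← sub_add_sub_cancel y z]
    exact norm_add_le_of_le htube
      ((G.norm_contAffine_sub_mean_le hs.1 (hpos s hsI k).posSemidef x).trans hx)
  have hlip : ‖matAct (G.contCov s k)⁻¹ (y - z)‖ ≤ κ⁻¹ * ‖y - z‖ := by
    rw [← div_eq_inv_mul, le_div_iff₀' hκ]
    exact mul_norm_matAct_inv_le (hpos s hsI k) hκ.le (hκs s hsI k) _
  have hsplit : score (G.mixDensity (G.contCov s)) y - -matAct (G.contCov s k)⁻¹ (z - G.mean k) =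
      score (G.mixDensity (G.contCov s)) y + matAct (G.contCov s k)⁻¹ (y - G.mean k) -
        matAct (G.contCov s k)⁻¹ (y - z) := by
    rw [← sub_sub_sub_cancel_right y z (G.mean k), matAct_sub _ (y - G.mean k)]
    abel
  exact hsplit ▸ norm_sub_le_of_le (hscore s hsI y hy) hlip

theorem exists_norm_sub_contAffine_le (m K : ℕ) {κ R w δ : ℝ} (r : ℝ) (hκ : 0 < κ) (hR : 0 ≤ R)
    (hw : 0 < w) (hδ : 0 < δ) :
    ∃ ε : ℝ, 0 < ε ∧
      ∀ (G : GaussianMixture m K) (T : ℝ) (φ : ℝ → Ground m → Ground m) (t : ℝ)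
        (Ω : Fin K → Set (Ground m)),
        (∀ k, G.cov k ≤ R • 1) → IsContinuousDAE G.law T φ → t ∈ Ico 0 T →
        (∀ k, κ • 1 ≤ G.contCov t k) →
        (∀ s ∈ Icc 0 t, G.WellSeparated (G.contCov s) Ω ε) →
        ∀ k, w ≤ G.weight k → ∀ x, mahalanobisSq (G.mean k) (G.cov k) x ≤ r ^ 2 →
          ‖φ t x - G.contAffine t k x‖ ≤ δ := by
  obtain ⟨ε, hε, hscore⟩ := exists_norm_score_add_le m K (R := R)
    (η := δ / 2 * Real.exp (-((κ⁻¹ + 1) * R))) (δ + √(R * r ^ 2)) hκ hw (by positivity)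
  refine ⟨ε, hε, fun G T φ t Ω hcov hφ ht hκt hsep k hk x hx => ?_⟩
  rcases isEmpty_or_nonempty (Fin m) with _ | _
  · rw [Subsingleton.elim (φ t x) (G.contAffine t k x), sub_self, norm_zero]
    exact hδ.le
  have htR : t ≤ R := by
    have := le_of_smul_le_smul_of_pos_right
      (((G.smul_one_le_contCov_iff k).1 (hκt k)).trans (hcov k)) zero_lt_one
    linarith [ht.1]
  refine G.norm_sub_contAffine_le hφ ht hκ hδ.le hκt 
    (b := √(R * r ^ 2)) (η := δ / 2 * Real.exp (-((κ⁻¹ + 1) * R))) ?_ (Real.le_sqrt_of_sq_le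
    ((norm_sq_sub_le_mul_mahalanobisSq (G.cov_posDef k) (hcov k) _ x).trans (by gcongr)))
    fun s hs y hy => ?_
  · calc δ / 2 * Real.exp (-((κ⁻¹ + 1) * R)) < δ * Real.exp (-((κ⁻¹ + 1) * R)) := by
          gcongr; linarith
      _ ≤ δ * Real.exp (-((κ⁻¹ + 1) * t)) := by gcongr
  · have hκs := fun j => (hκt j).trans (G.contCov_anti hs.2 j)
    exact hscore G (G.contCov s) (fun j => posDef_of_smul_one_le hκ (hκs j)) hκs k y
      ((G.contCov_le_cov hs.1 k).trans (hcov k)) hk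
      ((hsep s hs k).2.2 _ (mem_of_mem_nhds (hsep s hs k).1)) hy

end GaussianMixture

end Stability

theorem proposition1 (m K : ℕ) :
    -- the continuous DAE: exact pushforward
    (∀ (G : GaussianMixture m K) (T : ℝ) (φ : ℝ → Ground m → Ground m),
      IsContinuousDAE G.law T φ →
      ∀ t ∈ Set.Ico 0 T, (∀ k, (G.contCov t k).PosDef) →
        G.law.map (φ t) = gaussianSum G.weight G.mean (G.contCov t)) ∧
    -- the ordinary DAE: approximate pushforward, and its action on the clusters
    (∀ R w r δ : ℝ, 0 < R → 0 < w → 0 < r → 0 < δ → ∃ ε : ℝ, 0 < ε ∧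
      ∀ (G : GaussianMixture m K) (t : ℝ) (Ω : Fin K → Set (Ground m)),
        (∀ k, (R • (1 : Matrix (Fin m) (Fin m) ℝ) - G.cov k).PosSemidef) →
        0 ≤ t → t ≤ R →
        G.WellSeparated (G.noisyCov t) Ω ε →
        MeasureTheory.levyProkhorovEDist (G.law.map (dae G.law t))
          (gaussianSum G.weight G.mean (G.daeCov t)) ≤ ENNReal.ofReal δ ∧
        ∀ k, w ≤ G.weight k → ∀ x ∈ Ω k, mahalanobisSq (G.mean k) (G.cov k) x ≤ r ^ 2 →
          ‖dae G.law t x - G.daeAffine t k x‖ ≤ δ) ∧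
    -- the continuous DAE: its action on the clusters
    (∀ κ R w r δ : ℝ, 0 < κ → 0 < R → 0 < w → 0 < r → 0 < δ → ∃ ε : ℝ, 0 < ε ∧
      ∀ (G : GaussianMixture m K) (T : ℝ) (φ : ℝ → Ground m → Ground m) (t : ℝ)
        (Ω : Fin K → Set (Ground m)),
        (∀ k, (R • (1 : Matrix (Fin m) (Fin m) ℝ) - G.cov k).PosSemidef) →
        IsContinuousDAE G.law T φ → t ∈ Set.Ico 0 T →
        (∀ k, (G.contCov t k - κ • (1 : Matrix (Fin m) (Fin m) ℝ)).PosSemidef) →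
        (∀ s ∈ Set.Icc 0 t, G.WellSeparated (G.contCov s) Ω ε) →
        ∀ k, w ≤ G.weight k → ∀ x, mahalanobisSq (G.mean k) (G.cov k) x ≤ r ^ 2 →
          ‖φ t x - G.contAffine t k x‖ ≤ δ) ∧
    -- the affine maps fix the cluster centers and are contractions
    (∀ (G : GaussianMixture m K) (t : ℝ) (k : Fin K), 0 < t →
      (G.daeAffine t k (G.mean k) = G.mean k ∧
        ∃ q : NNReal, ContractingWith q (G.daeAffine t k)) ∧
      ((G.contCov t k).PosDef →
        G.contAffine t k (G.mean k) = G.mean k ∧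
        ∃ q : NNReal, ContractingWith q (G.contAffine t k))) := by
  refine ⟨fun G T φ h t ht hpos => G.map_of_isContinuousDAE h ht fun k => (hpos k).posSemidef,
    fun R w r δ hR hw _ hδ => ?_, fun κ R w r δ hκ hR hw _ hδ => ?_, fun G t k ht => ?_⟩
  · obtain ⟨ε₁, hε₁, hlaw⟩ := GaussianMixture.exists_levyProkhorovEDist_dae_le m K hR hδ
    obtain ⟨ε₂, hε₂, hmap⟩ := GaussianMixture.exists_norm_dae_sub_daeAffine_le m K r hR hw hδ
    refine ⟨min ε₁ ε₂, lt_min hε₁ hε₂, fun G t Ω hcov ht htR hsep => ⟨?_, ?_⟩⟩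
    · exact hlaw G t Ω hcov ht htR (hsep.mono (min_le_left ε₁ ε₂))
    · exact fun k hk x hx hxr => hmap G t ht htR k x (hcov k) hk hxr
        ((hsep.mono (min_le_right ε₁ ε₂) k).2.2 x hx)
  · exact GaussianMixture.exists_norm_sub_contAffine_le m K r hκ hR.le hw hδ
  · exact ⟨⟨G.daeAffine_mean t k, G.exists_contractingWith_daeAffine ht k⟩,
      fun h => ⟨G.contAffine_mean t k, G.exists_contractingWith_contAffine ht k h.posSemidef⟩⟩
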